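/- **Setup.** Let $n,d\ge 0$ and let $a_1,\dots,a_n\in\mathfrak t^d=\mathbb Z^d$ be nonzero integer vectors (repetitions allowed) such that the map $\mathfrak t^n=\mathbb Z^n\to\mathfrak t^d$, $x_i\mapsto a_i$ (where $x_1,\dots,x_n$ is the standard basis), has rank $d$. Let $\mathfrak t^k$ be its kernel, with inclusion $\iota:\mathfrak t^k\to\mathfrak t^n$, and let $T^k=\ker(T^n\to T^d)$ be the kernel of the corresponding homomorphism of split tori over $\mathbb Z$, a possibly disconnected diagonalizable group scheme. Let $r\in\mathbb Z^n=(\mathfrak t^n)^*$ be such that the arrangement $\tilde{\mathcal A}$ of hyperplanes $\tilde H_i=\{v\in(\mathfrak t^d)^*_{\mathbb R}\mid v\cdot a_i+r_i=0\}$ is simple, i.e. any $m$ of the (labelled) $\tilde H_i$ with nonempty intersection intersect in codimension $m$; thus $\tilde{\mathcal A}$ is a simplification of the central arrangement $\mathcal A$ with normal vectors $a_i$. Let $\alpha$ be the character of $T^k$ obtained by restricting the character of $T^n$ with weight $r$. Let $T^k$ act on $T^*\mathbb A^n=\mathbb A^n\times(\mathbb A^n)^*$ through $T^n$ by $t\cdot(z,w)=(tz,t^{-1}w)$,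 with moment map $\mu(z,w)=\iota^*\sum_i z_iw_ie_i\in(\mathfrak t^k)^*$, where $(e_i)$ is the basis of $(\mathfrak t^n)^*$ dual to $(x_i)$. Let $\lambda\in(\mathfrak t^k)^*=\operatorname{Hom}(\mathfrak t^k,\mathbb Z)$ be a regular value of $\mu$, i.e. over $\mathbb C$ the differential of $\mu$ is surjective at every point of $\mu^{-1}(\lambda)$. Let $$\mathfrak M_\lambda(\tilde{\mathcal A})=\mu^{-1}(\lambda)/\!\!/_{\alpha}T^k=\operatorname{Proj}\bigoplus_{m\ge0}\{f\in\mathcal O_{\mu^{-1}(\lambda)}\mid \nu^*(f)=\alpha^m\otimes f\},$$ a scheme over $\mathbb Z$, where $\nu:T^k\times\mu^{-1}(\lambda)\to\mu^{-1}(\lambda)$ is the action. Let $\Delta_{\mathcal A}$ be the matroid complex, whose faces are the sets $S\subseteq\{1,\dots,n\}$ such that the vectors $a_i$, $i\in S$, are linearly independent, let $f_i$ be the number of its faces of cardinality $i$, and let $h_{\mathcal A}(q)=\sum_{i=0}^d f_i\,q^i(1-q)^{d-i}$ be its $h$-polynomial. **Proposition.** The variety $\mathfrak M_\lambda(\tilde{\mathcal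 A})$ has polynomial point count: there is a polynomial $\nu$ with integer coefficients such that, for every finite field $\mathbb F_q$ of sufficiently large characteristic, the number of $\mathbb F_q$-rational points of $\mathfrak M_\lambda(\tilde{\mathcal A})$ is finite and equal to $\nu(q)$. This polynomial is given by $$\nu(q)=q^{2d}\cdot h_{\mathcal A}(q^{-1}).$$ -/

import Mathlib

open AlgebraicGeometry

noncomputable section

namespace Hypertoric

/-! ### Simplicial complexes: the matroid complex and the `h`-polynomial -/

/-- The linear map `𝔱ⁿ = ℤⁿ → 𝔱ᵈ = ℤᵈ` sending the `i`-th basis vector to `a i`. -/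
def latticeMap {n d : ℕ} (a : Fin n → Fin d → ℤ) : (Fin n → ℤ) →ₗ[ℤ] (Fin d → ℤ) :=
  Fintype.linearCombination ℤ a

open Classical in
/-- The faces of the matroid complex `Δ_𝒜`: the sets `S` of labels such that the vectors
`a i`, `i ∈ S`, are linearly independent. -/
def matroidComplex {n d : ℕ} (a : Fin n → Fin d → ℤ) : Finset (Finset (Fin n)) :=
  Finset.univ.filter fun S => LinearIndependent ℤ fun i : S => a i

/-- The number `f_i` of faces of cardinality `i` of a finite complex. -/
def fNumber {n : ℕ} (Δ : Finset (Finset (Fin n))) (i : ℕ) : ℕ :=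
  (Δ.filter fun S => S.card = i).card

/-- The `h`-polynomial `∑_{i=0}^d f_i q^i (1-q)^{d-i}` of a complex of dimension `d - 1`. -/
def hPolynomial {n : ℕ} (Δ : Finset (Finset (Fin n))) (d : ℕ) : Polynomial ℤ :=
  ∑ i ∈ Finset.range (d + 1),
    (fNumber Δ i : Polynomial ℤ) * Polynomial.X ^ i * (1 - Polynomial.X) ^ (d - i)

/-! ### Arrangements -/

/-- The affine hyperplane `{v ∈ (𝔱ᵈ)^* | v · a + r = 0}` in its real form. -/
def hyperplane {d : ℕ} (a : Fin d → ℤ) (r : ℤ) : AffineSubspace ℝ (Fin d → ℝ) where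
  carrier := {v | (∑ j, v j * (a j : ℝ)) + (r : ℝ) = 0}
  smul_vsub_vadd_mem' := by
    intro c p₁ p₂ p₃ h₁ h₂ h₃
    simp only [Set.mem_ofPred_eq] at *
    simp only [vsub_eq_sub, vadd_eq_add, Pi.add_apply, Pi.smul_apply, Pi.sub_apply, smul_eq_mul]
    have : ∑ j, (c * (p₁ j - p₂ j) + p₃ j) * (a j : ℝ)
        = c * (∑ j, p₁ j * (a j : ℝ) - ∑ j, p₂ j * (a j : ℝ)) + ∑ j, p₃ j * (a j : ℝ) := by
      rw [← Finset.sum_sub_distrib, Finset.mul_sum, ← Finset.sum_add_distrib]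
      exact Finset.sum_congr rfl fun j _ => by ring
    rw [this]
    linear_combination c * h₁ - c * h₂ + h₃

/-- The arrangement of the hyperplanes `H_i = {v | v · a_i + r_i = 0}` is simple: any `m` of its
(labelled) hyperplanes with nonempty intersection intersect in codimension `m`. -/
def IsSimple {n d : ℕ} (a : Fin n → Fin d → ℤ) (r : Fin n → ℤ) : Prop :=
  ∀ S : Finset (Fin n),
    ((⨅ i ∈ S, hyperplane (a i) (r i) : AffineSubspace ℝ (Fin d → ℝ)) : Set (Fin d → ℝ)).Nonempty →
      Module.finrank ℝ (⨅ i ∈ S, hyperplane (a i) (r i)).direction + S.card = d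

/-! ### The moment map -/

/-- The lattice `𝔱ᵏ = ker (𝔱ⁿ → 𝔱ᵈ)`. -/
abbrev lieKernel {n d : ℕ} (a : Fin n → Fin d → ℤ) : Submodule ℤ (Fin n → ℤ) :=
  LinearMap.ker (latticeMap a)

/-- The moment map `μ(z,w) = ι^* ∑ z_i w_i e_i` on `K`-points, with values in
`(𝔱ᵏ)^* ⊗ K = Hom(𝔱ᵏ, K)`. -/
def momentMap {n d : ℕ} (a : Fin n → Fin d → ℤ) {K : Type*} [CommRing K] (z w : Fin n → K) :
    lieKernel a →ₗ[ℤ] K where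
  toFun x := ∑ i, (x.1 i : K) * (z i * w i)
  map_add' x y := by
    rw [← Finset.sum_add_distrib]
    exact Finset.sum_congr rfl fun i _ => by simp [add_mul]
  map_smul' c x := by
    simp only [zsmul_eq_mul, Finset.mul_sum, RingHom.id_apply]
    exact Finset.sum_congr rfl fun i _ => by simp [mul_assoc]

/-- The differential of the moment map at `(z,w)` in the direction `(z',w')`. -/
def momentMapDifferential {n d : ℕ} (a : Fin n → Fin d → ℤ) {K : Type*} [CommRing K]
    (z w z' w' : Fin n → K) : lieKernel a →ₗ[ℤ] K :=
  momentMap a z w' + momentMap a z' w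

/-- `momentMapDifferential` is the linear part of the moment map. -/
theorem momentMap_add_smul {n d : ℕ} (a : Fin n → Fin d → ℤ) {K : Type*} [CommRing K]
    (z w z' w' : Fin n → K) (t : K) (x : lieKernel a) :
    momentMap a (z + t • z') (w + t • w') x =
      momentMap a z w x + t * momentMapDifferential a z w z' w' x
        + t ^ 2 * momentMap a z' w' x := by
  simp only [momentMapDifferential, momentMap, LinearMap.coe_mk, AddHom.coe_mk,
    LinearMap.add_apply, Finset.mul_sum, mul_add, ← Finset.sum_add_distrib]
  exact Finset.sum_congr rfl fun i _ => by
    simp only [Pi.add_apply, Pi.smul_apply, smul_eq_mul]; ring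

/-- `lam ∈ (𝔱ᵏ)^*` is a regular value of `μ` (over `ℂ`): the differential of `μ` is surjective at
every point of the fibre over `lam`. -/
def IsRegularValue {n d : ℕ} (a : Fin n → Fin d → ℤ) (lam : lieKernel a →ₗ[ℤ] ℤ) : Prop :=
  ∀ z w : Fin n → ℂ, (∀ x, momentMap a z w x = ((lam x : ℤ) : ℂ)) →
    ∀ ξ : lieKernel a →ₗ[ℤ] ℂ, ∃ z' w' : Fin n → ℂ, momentMapDifferential a z w z' w' = ξ

/-! ### The fibre `μ⁻¹(lam)` as an affine scheme over `ℤ` and the action of `Tᵏ` -/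

/-- The ideal of `μ⁻¹(lam)` in `ℤ[z_1,…,z_n,w_1,…,w_n]`, generated by the functions
`⟨μ(z,w) - lam, x⟩` for `x ∈ 𝔱ᵏ`. The variables `Sum.inl i` and `Sum.inr i` are `z_i` and `w_i`. -/
def fiberIdeal {n d : ℕ} (a : Fin n → Fin d → ℤ) (lam : lieKernel a →ₗ[ℤ] ℤ) :
    Ideal (MvPolynomial (Fin n ⊕ Fin n) ℤ) :=
  Ideal.span (Set.range fun x : lieKernel a =>
    momentMap a (fun i => MvPolynomial.X (Sum.inl i)) (fun i => MvPolynomial.X (Sum.inr i)) x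
      - MvPolynomial.C (lam x))

/-- The coordinate ring of `μ⁻¹(lam)` over `ℤ`. -/
abbrev FiberRing {n d : ℕ} (a : Fin n → Fin d → ℤ) (lam : lieKernel a →ₗ[ℤ] ℤ) : Type :=
  MvPolynomial (Fin n ⊕ Fin n) ℤ ⧸ fiberIdeal a lam

/-- The transpose `(𝔱ᵈ)^* → (𝔱ⁿ)^*`, i.e. the pull-back of characters along `Tⁿ → Tᵈ`,
sending `u` to `(u · a_i)_i`. -/
def characterMap {n d : ℕ} (a : Fin n → Fin d → ℤ) : (Fin d → ℤ) →ₗ[ℤ] (Fin n → ℤ) :=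
  LinearMap.pi fun i => Fintype.linearCombination ℤ (a i)

/-- The character group of `Tᵏ = ker (Tⁿ → Tᵈ)`. The diagonalizable group scheme `Tᵏ` over `ℤ`
is the spectrum of the group ring of this (possibly not torsion-free) group. -/
abbrev Characters {n d : ℕ} (a : Fin n → Fin d → ℤ) : Type :=
  (Fin n → ℤ) ⧸ LinearMap.range (characterMap a)

/-- The restriction to `Tᵏ` of the character of `Tⁿ` with weight `r`. -/
def restrictCharacter {n d : ℕ} (a : Fin n → Fin d → ℤ) (r : Fin n → ℤ) : Characters a :=
  Submodule.Quotient.mk r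

/-- The map `ν^* : 𝒪(μ⁻¹(lam)) → 𝒪(Tᵏ) ⊗ 𝒪(μ⁻¹(lam))` given by the action
`t · (z,w) = (t z, t⁻¹ w)`. The target is written as the group ring of the characters of `Tᵏ`
with coefficients in `𝒪(μ⁻¹(lam))`; the pure tensor `χ ⊗ f` is `AddMonoidAlgebra.single χ f`. -/
def coaction {n d : ℕ} (a : Fin n → Fin d → ℤ) (lam : lieKernel a →ₗ[ℤ] ℤ) :
    FiberRing a lam →ₐ[ℤ] AddMonoidAlgebra (FiberRing a lam) (Characters a) :=
  Ideal.Quotient.liftₐ (fiberIdeal a lam)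
    (MvPolynomial.aeval (Sum.elim
      (fun i => AddMonoidAlgebra.single (restrictCharacter a (Pi.single i 1))
        (Ideal.Quotient.mk (fiberIdeal a lam) (MvPolynomial.X (Sum.inl i))))
      (fun i => AddMonoidAlgebra.single (-restrictCharacter a (Pi.single i 1))
        (Ideal.Quotient.mk (fiberIdeal a lam) (MvPolynomial.X (Sum.inr i))))))
    (by
      intro f hf
      refine Submodule.span_induction (p := fun f _ => MvPolynomial.aeval _ f = 0)
        ?_ (map_zero _) ?_ ?_ hf
      · rintro _ ⟨x, rfl⟩
        have h0 : Ideal.Quotient.mk (fiberIdeal a lam)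
            (momentMap a (fun i => MvPolynomial.X (Sum.inl i))
              (fun i => MvPolynomial.X (Sum.inr i)) x - MvPolynomial.C (lam x)) = 0 :=
          Ideal.Quotient.eq_zero_iff_mem.2 (Ideal.subset_span ⟨x, rfl⟩)
        simp only [momentMap, LinearMap.coe_mk, AddHom.coe_mk, map_sub, map_sum, map_mul,
          map_intCast, eq_intCast] at h0 ⊢
        simp only [MvPolynomial.aeval_X, Sum.elim_inl, Sum.elim_inr,
          AddMonoidAlgebra.single_mul_single, add_neg_cancel]
        have := congrArg (AddMonoidAlgebra.singleZeroRingHom (R := FiberRing a lam)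
          (M := Characters a)) h0
        simp only [map_sub, map_sum, map_mul (AddMonoidAlgebra.singleZeroRingHom), map_intCast,
          map_zero] at this
        rw [← this]
        refine congrArg (· - _) (Finset.sum_congr rfl fun i _ => congrArg (_ * ·) ?_)
        rw [← map_mul (AddMonoidAlgebra.singleZeroRingHom)]
        rfl
      · intro f g _ _ hf hg
        rw [map_add, hf, hg, add_zero]
      · intro c f _ hf
        rw [smul_eq_mul, map_mul, hf, mul_zero])

/-- The semi-invariants `{f | ν^* f = α^m ⊗ f}`, where `α` is the restriction of `r` to `Tᵏ`. -/
def semiInvariants {n d : ℕ} (a : Fin n → Fin d → ℤ) (r : Fin n → ℤ)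
    (lam : lieKernel a →ₗ[ℤ] ℤ) (m : ℕ) : AddSubgroup (FiberRing a lam) where
  carrier := {f | coaction a lam f = AddMonoidAlgebra.single (m • restrictCharacter a r) f}
  zero_mem' := by simp
  add_mem' := by
    intro f g hf hg
    simp only [Set.mem_ofPred_eq] at *
    rw [map_add, hf, hg, AddMonoidAlgebra.single_add]
  neg_mem' := by
    intro f hf
    simp only [Set.mem_ofPred_eq] at *
    rw [map_neg, hf, AddMonoidAlgebra.single_neg]

theorem one_mem_semiInvariants {n d : ℕ} (a : Fin n → Fin d → ℤ) (r : Fin n → ℤ)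
    (lam : lieKernel a →ₗ[ℤ] ℤ) : (1 : FiberRing a lam) ∈ semiInvariants a r lam 0 := by
  change coaction a lam 1 = AddMonoidAlgebra.single (0 • restrictCharacter a r) 1
  rw [map_one, zero_smul, AddMonoidAlgebra.one_def]

theorem mul_mem_semiInvariants {n d : ℕ} (a : Fin n → Fin d → ℤ) (r : Fin n → ℤ)
    (lam : lieKernel a →ₗ[ℤ] ℤ) {i j : ℕ} {f g : FiberRing a lam}
    (hf : f ∈ semiInvariants a r lam i) (hg : g ∈ semiInvariants a r lam j) :
    f * g ∈ semiInvariants a r lam (i + j) := by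
  change coaction a lam (f * g) = AddMonoidAlgebra.single ((i + j) • restrictCharacter a r) (f * g)
  change coaction a lam f = _ at hf
  change coaction a lam g = _ at hg
  rw [map_mul, hf, hg, AddMonoidAlgebra.single_mul_single, add_smul]

/-! ### The GIT quotient -/

/-- The ring `⨁_m {f | ν^* f = α^m ⊗ f}`, written as the ring of polynomials `∑ f_m t^m` whose
`m`-th coefficient is a semi-invariant of weight `α^m`. -/
def semiInvariantRing {n d : ℕ} (a : Fin n → Fin d → ℤ) (r : Fin n → ℤ)
    (lam : lieKernel a →ₗ[ℤ] ℤ) : Subring (Polynomial (FiberRing a lam)) where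
  carrier := {p | ∀ m, p.coeff m ∈ semiInvariants a r lam m}
  zero_mem' m := by simp
  one_mem' m := by
    rw [Polynomial.coeff_one]
    split_ifs with h
    · subst h; exact one_mem_semiInvariants a r lam
    · exact (semiInvariants a r lam m).zero_mem
  add_mem' hp hq m := by
    rw [Polynomial.coeff_add]; exact (semiInvariants a r lam m).add_mem (hp m) (hq m)
  neg_mem' hp m := by
    rw [Polynomial.coeff_neg]; exact (semiInvariants a r lam m).neg_mem (hp m)
  mul_mem' := by
    intro p q hp hq m
    rw [Polynomial.coeff_mul]
    refine AddSubgroup.sum_mem _ fun x hx => ?_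
    rw [← Finset.HasAntidiagonal.mem_antidiagonal.1 hx]
    exact mul_mem_semiInvariants a r lam (hp _) (hq _)

/-- The degree `m` part of `semiInvariantRing`: the elements of the form `f t^m`. -/
def semiInvariantGrading {n d : ℕ} (a : Fin n → Fin d → ℤ) (r : Fin n → ℤ)
    (lam : lieKernel a →ₗ[ℤ] ℤ) (m : ℕ) : AddSubgroup (semiInvariantRing a r lam) where
  carrier := {p | ∀ j, j ≠ m → p.1.coeff j = 0}
  zero_mem' j _ := by simp
  add_mem' hp hq j hj := by simp [hp j hj, hq j hj]
  neg_mem' hp j hj := by simp [hp j hj]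

/-- The degree `m` component of an element of `semiInvariantRing`. -/
def component {n d : ℕ} (a : Fin n → Fin d → ℤ) (r : Fin n → ℤ)
    (lam : lieKernel a →ₗ[ℤ] ℤ) (m : ℕ) (p : semiInvariantRing a r lam) :
    semiInvariantGrading a r lam m :=
  ⟨⟨Polynomial.monomial m (p.1.coeff m), fun j => by
      rw [Polynomial.coeff_monomial]
      split_ifs with h
      · subst h; exact p.2 _
      · exact (semiInvariants a r lam j).zero_mem⟩,
    fun j hj => by simp [Polynomial.coeff_monomial, hj.symm]⟩

theorem coeff_coeAddMonoidHom {n d : ℕ} (a : Fin n → Fin d → ℤ) (r : Fin n → ℤ)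
    (lam : lieKernel a →ₗ[ℤ] ℤ) (x : DirectSum ℕ fun m => semiInvariantGrading a r lam m) (j : ℕ) :
    (DirectSum.coeAddMonoidHom (semiInvariantGrading a r lam) x).1.coeff j =
      (x j).1.1.coeff j := by
  classical
  induction x using DirectSum.induction_on with
  | zero => simp
  | of i y =>
    rw [DirectSum.coeAddMonoidHom_of]
    by_cases h : i = j
    · subst h; rw [DirectSum.of_eq_same]
    · rw [DirectSum.of_eq_of_ne _ _ _ (Ne.symm h), y.2 j (Ne.symm h)]; rfl
  | add x y hx hy => simp [hx, hy]

instance gradedRing {n d : ℕ} (a : Fin n → Fin d → ℤ) (r : Fin n → ℤ)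
    (lam : lieKernel a →ₗ[ℤ] ℤ) : GradedRing (semiInvariantGrading a r lam) where
  one_mem j hj := by simp [Polynomial.coeff_one, hj]
  mul_mem i j p q hp hq m hm := by
    change (p.1 * q.1).coeff m = 0
    rw [Polynomial.coeff_mul]
    refine Finset.sum_eq_zero fun x hx => ?_
    by_cases h1 : x.1 = i
    · have h2 : x.2 ≠ j := fun h2 => hm (by rw [← Finset.HasAntidiagonal.mem_antidiagonal.1 hx, h1, h2])
      rw [hq _ h2, mul_zero]
    · rw [hp _ h1, zero_mul]
  decompose' p := DirectSum.mk _ p.1.support fun m => component a r lam m p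
  left_inv p := by
    classical
    refine Subtype.ext (Polynomial.ext fun j => ?_)
    rw [coeff_coeAddMonoidHom]
    by_cases h : j ∈ p.1.support
    · rw [DirectSum.mk_apply_of_mem h]
      simp [component]
    · rw [DirectSum.mk_apply_of_notMem h, Polynomial.notMem_support_iff.1 h]
      rfl
  right_inv x := by
    classical
    refine DFinsupp.ext fun m => Subtype.ext (Subtype.ext (Polynomial.ext fun j => ?_))
    have hx := coeff_coeAddMonoidHom a r lam x m
    by_cases hj : j = m
    · subst hj
      by_cases h : j ∈ (DirectSum.coeAddMonoidHom (semiInvariantGrading a r lam) x).1.support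
      · rw [DirectSum.mk_apply_of_mem h]
        simpa [component] using hx
      · rw [DirectSum.mk_apply_of_notMem h, ← hx, Polynomial.notMem_support_iff.1 h]
        rfl
    · rw [Subtype.prop (x m) j hj]
      exact Subtype.prop ((DirectSum.mk (fun m => semiInvariantGrading a r lam m) _ _ :
        DirectSum ℕ fun m => semiInvariantGrading a r lam m) m) j hj

/-- The variety `𝔐_lam(𝒜̃) = μ⁻¹(lam) //_α Tᵏ = Proj ⨁_m {f | ν^* f = α^m ⊗ f}` over `ℤ`. -/
def hypertoricVariety {n d : ℕ} (a : Fin n → Fin d → ℤ) (r : Fin n → ℤ)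
    (lam : lieKernel a →ₗ[ℤ] ℤ) : Scheme.{0} :=
  Proj (semiInvariantGrading a r lam)

/-! ### Point counts -/

/-- The polynomial `ν` counts the points of the scheme `X` over `ℤ`: for every finite field `F` of
sufficiently large characteristic, the set of `F`-rational points of `X` is finite and has
`ν (#F)` elements. (A morphism `Spec F ⟶ X` is the same as a rational point of `X ⊗ F`.) -/
def IsPointCount (X : Scheme.{0}) (ν : Polynomial ℤ) : Prop :=
  ∃ N : ℕ, ∀ (F : Type) [Field F] [Finite F], N ≤ ringChar F →
    Finite (Spec (CommRingCat.of F) ⟶ X) ∧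
      (Nat.card (Spec (CommRingCat.of F) ⟶ X) : ℤ) = ν.eval (Nat.card F : ℤ)

end Hypertoric

end

/-!
# The point count of a hypertoric variety at a regular value of the moment map

The coaction is diagonal on monomials, so the semi-invariants of weight `α ^ m` are spanned by the
monomials `z ^ p * w ^ s` for which `p - s - m r` lies in the lattice `weightLattice a` of characters
of `Tᵈ`. The functions `x i = z i * w i` are invariant. At the points of `μ⁻¹(lam)` over a field `F`
they take values in `productSpace a lam F`, which in large characteristic is an affine space of
dimension `d`, in which the vanishing of the `x i` for `i` in an independent set `S` cuts out an
affine subspace of codimension `#S` (`eventually_card_productSpace`). Regularity of `lam` means that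
only the `x i` with `i` in an independent set can vanish simultaneously, over `ℂ` and then in large
characteristic (`eventually_indep`).

An `F`-point of `Proj` is a homogeneous prime with a local homomorphism from its homogeneous
localization to `F`, and it is determined by the values of homogeneous fractions
(`FieldPoint.ext_val`). The monomials that do not vanish at such a point form a face: they tell which
of the `z i` and `w i` are nonzero. Together with the values of the `x i` this gives a point `(z, w)`
of `μ⁻¹(lam)` in which each pair `(z i, w i)` is `(1, y)`, `(0, 1)` or `(0, 0)`. What is left is the
ratio of the values of the monomials at the two points, and this is a homomorphism to `Fˣ` from the
lattice of those weights in `weightLattice a` that vanish on `Z = {i | z i = w i = 0}`. So the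
`F`-points are in bijection with these normal forms (`NormalForm.toFieldPoint_injective`,
`NormalForm.toFieldPoint_surjective`). Conversely a normal form yields a homomorphism from the ring of
semi-invariants to `F`, because the lattice is a direct summand of `weightLattice a`; the irrelevant
ideal is not killed because the signs of a weight can be prescribed on an independent set. Counting
these normal forms directly avoids finding `F`-rational representatives in `μ⁻¹(lam)` for the
points of the quotient, which need not exist.

The lattice has rank `d - #Z` (`Indep.finrank_faceLattice`), and hence a point `(z, w)` carries
`(q - 1) ^ (d - #Z)` torus points. For given `x` the sum over the normalized points with
`z i * w i = x i` factors, each `i` with `x i = 0` contributing `2 + 1 / (q - 1) = 1 + q / (q - 1)`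
and the others `1`. Expanding the product over the sets `S` of labels with `x i = 0` and summing over
`x` gives the count `∑ S, q ^ d * (q - 1) ^ (d - #S)` over the independent sets `S`
(`card_normalForm`), which is `q ^ (2 d) * h (q⁻¹)`.
-/

open AlgebraicGeometry

noncomputable section

namespace Hypertoric

/-! ### Points of `Proj` with values in a field -/

section FieldPoints

variable {A σ : Type} [CommRing A] [SetLike σ A] [AddSubgroupClass σ A]
variable (𝒜 : ℕ → σ) [GradedRing 𝒜] (F : Type) [Field F]

/-- A field-valued point of `Proj 𝒜`, in algebraic terms: a relevant homogeneous prime together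
with a local homomorphism from its homogeneous localization to the field. -/
def FieldPoint : Type :=
  Σ x : ProjectiveSpectrum 𝒜,
    {f : HomogeneousLocalization.AtPrime 𝒜 x.asHomogeneousIdeal.toIdeal →+* F // IsLocalHom f}

/-- Morphisms `Spec F ⟶ Proj 𝒜` are field-valued points in the algebraic sense. -/
def fieldPointEquiv : (Spec (CommRingCat.of F) ⟶ Proj 𝒜) ≃ FieldPoint 𝒜 F :=
  (SpecToEquivOfLocalRing (Proj 𝒜) (CommRingCat.of F)).trans
    (Equiv.sigmaCongrRight fun x =>
      { toFun := fun f => ⟨f.1.hom.comp (Proj.stalkIso' 𝒜 x).symm.toRingHom, by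
          have := f.2
          constructor
          intro a ha
          have h1 := (isUnit_map_iff f.1.hom _).1 ha
          exact (isUnit_map_iff (Proj.stalkIso' 𝒜 x).symm _).1 h1⟩
        invFun := fun f => ⟨CommRingCat.ofHom (f.1.comp (Proj.stalkIso' 𝒜 x).toRingHom), by
          have := f.2
          constructor
          intro a ha
          have h1 := (isUnit_map_iff f.1 _).1 ha
          exact (isUnit_map_iff (Proj.stalkIso' 𝒜 x) _).1 h1⟩
        left_inv := fun f => by
          apply Subtype.ext
          ext a
          exact congrArg f.1.hom ((Proj.stalkIso' 𝒜 x).symm_apply_apply a)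
        right_inv := fun f => by
          apply Subtype.ext
          ext a
          exact congrArg f.1 ((Proj.stalkIso' 𝒜 x).apply_symm_apply a) })

variable {𝒜 F}

namespace FieldPoint

/-- The homogeneous prime ideal underlying a field-valued point. -/
def prime (P : FieldPoint 𝒜 F) : Ideal A := P.1.asHomogeneousIdeal.toIdeal

instance (P : FieldPoint 𝒜 F) : P.prime.IsPrime := P.1.isPrime

open Classical in
/-- The value of the homogeneous fraction `a / b` at a field-valued point. The junk value `0` is
taken where `b` vanishes, or if `a` and `b` are not homogeneous of a common degree. -/
def val (P : FieldPoint 𝒜 F) (a b : A) : F :=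
  if h : ∃ m, a ∈ 𝒜 m ∧ b ∈ 𝒜 m ∧ b ∉ P.prime then
    P.2.1 (HomogeneousLocalization.mk
      ⟨h.choose, ⟨a, h.choose_spec.1⟩, ⟨b, h.choose_spec.2.1⟩, h.choose_spec.2.2⟩)
  else 0

theorem val_eq (P : FieldPoint 𝒜 F) {a b : A} {m : ℕ} (ha : a ∈ 𝒜 m) (hb : b ∈ 𝒜 m)
    (h : b ∉ P.prime) :
    P.val a b = P.2.1 (HomogeneousLocalization.mk ⟨m, ⟨a, ha⟩, ⟨b, hb⟩, h⟩) := by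
  have h' : ∃ m, a ∈ 𝒜 m ∧ b ∈ 𝒜 m ∧ b ∉ P.prime := ⟨m, ha, hb, h⟩
  rw [val, dif_pos h']
  congr 1
  apply HomogeneousLocalization.val_injective
  simp only [HomogeneousLocalization.val_mk]

theorem val_of_mem (P : FieldPoint 𝒜 F) {a b : A} (h : b ∈ P.prime) : P.val a b = 0 := by
  rw [val, dif_neg]
  rintro ⟨m, -, -, h'⟩
  exact h' h

theorem val_self (P : FieldPoint 𝒜 F) {b : A} {m : ℕ} (hb : b ∈ 𝒜 m) (h : b ∉ P.prime) :
    P.val b b = 1 := by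
  rw [P.val_eq hb hb h, ← map_one P.2.1]
  congr 1
  apply HomogeneousLocalization.val_injective
  simp only [HomogeneousLocalization.val_mk, HomogeneousLocalization.val_one]
  exact Localization.mk_self (⟨b, h⟩ : P.prime.primeCompl)

theorem val_add (P : FieldPoint 𝒜 F) {a a' b : A} {m : ℕ} (ha : a ∈ 𝒜 m) (ha' : a' ∈ 𝒜 m)
    (hb : b ∈ 𝒜 m) : P.val (a + a') b = P.val a b + P.val a' b := by
  by_cases h : b ∈ P.prime
  · simp [P.val_of_mem h]
  rw [P.val_eq ha hb h, P.val_eq ha' hb h, P.val_eq (add_mem ha ha') hb h, ← map_add]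
  congr 1
  apply HomogeneousLocalization.val_injective
  simp only [HomogeneousLocalization.val_mk, HomogeneousLocalization.val_add]
  rw [Localization.add_mk_self]

/-- `val` with a fixed denominator, as an additive map. -/
def valAddHom (P : FieldPoint 𝒜 F) {b : A} {m : ℕ} (hb : b ∈ 𝒜 m) : 𝒜 m →+ F :=
  AddMonoidHom.mk' (fun a => P.val a b) fun a a' =>
    P.val_add (SetLike.coe_mem a) (SetLike.coe_mem a') hb

theorem val_mul (P : FieldPoint 𝒜 F) {a a' b b' : A} {m m' : ℕ} (ha : a ∈ 𝒜 m) (hb : b ∈ 𝒜 m)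
    (ha' : a' ∈ 𝒜 m') (hb' : b' ∈ 𝒜 m') :
    P.val (a * a') (b * b') = P.val a b * P.val a' b' := by
  by_cases h : b ∈ P.prime
  · rw [P.val_of_mem h, P.val_of_mem (Ideal.mul_mem_right _ _ h), zero_mul]
  by_cases h' : b' ∈ P.prime
  · rw [P.val_of_mem h', P.val_of_mem (Ideal.mul_mem_left _ _ h'), mul_zero]
  have h2 : b * b' ∉ P.prime := fun h3 => ((Ideal.IsPrime.mem_or_mem inferInstance h3).elim h h')
  rw [P.val_eq ha hb h, P.val_eq ha' hb' h',
    P.val_eq (SetLike.mul_mem_graded ha ha') (SetLike.mul_mem_graded hb hb') h2, ← map_mul]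
  congr 1

theorem val_eq_zero_iff (P : FieldPoint 𝒜 F) {a b : A} {m : ℕ} (ha : a ∈ 𝒜 m) (hb : b ∈ 𝒜 m)
    (h : b ∉ P.prime) : P.val a b = 0 ↔ a ∈ P.prime := by
  constructor
  · intro h0
    by_contra h1
    have := P.val_mul ha hb hb ha
    rw [h0, zero_mul, mul_comm b a, P.val_self (SetLike.mul_mem_graded ha hb)] at this
    · exact one_ne_zero this
    · exact fun h3 => ((Ideal.IsPrime.mem_or_mem inferInstance h3).elim h1 h)
  · intro h0
    rw [P.val_eq ha hb h]
    have := P.2.2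
    by_contra h1
    have h2 := (isUnit_map_iff P.2.1 _).1 (isUnit_iff_ne_zero.2 h1)
    rw [← HomogeneousLocalization.isUnit_iff_isUnit_val, HomogeneousLocalization.val_mk] at h2
    have h3 := (IsLocalization.AtPrime.isUnit_mk'_iff (Localization.AtPrime P.prime) P.prime a
      ⟨b, h⟩).1 (by rw [← Localization.mk_eq_mk']; exact h2)
    exact h3 h0

theorem val_mul_val (P : FieldPoint 𝒜 F) {a b c : A} {m : ℕ} (ha : a ∈ 𝒜 m) (hb : b ∈ 𝒜 m)
    (hc : c ∈ 𝒜 m) (h : b ∉ P.prime) : P.val a b * P.val b c = P.val a c := by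
  rw [← P.val_mul ha hb hb hc, mul_comm b c, P.val_mul ha hc hb hb, P.val_self hb h, mul_one]

theorem val_eq_div (P : FieldPoint 𝒜 F) {a b c : A} {m : ℕ} (ha : a ∈ 𝒜 m) (hb : b ∈ 𝒜 m)
    (hc : c ∈ 𝒜 m) (h : c ∉ P.prime) : P.val a b = P.val a c / P.val b c := by
  by_cases hbP : b ∈ P.prime
  · rw [P.val_of_mem hbP, (P.val_eq_zero_iff hb hc h).2 hbP, div_zero]
  rw [eq_div_iff (fun h0 => hbP ((P.val_eq_zero_iff hb hc h).1 h0)), P.val_mul_val ha hb hc hbP]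

theorem mem_prime_iff (P : FieldPoint 𝒜 F) {b : A} {m : ℕ} (hb : b ∈ 𝒜 m) :
    b ∈ P.prime ↔ P.val b b = 0 := by
  by_cases h : b ∈ P.prime
  · simp [h, P.val_of_mem h]
  · simp [h, P.val_self hb h]

/-- A field-valued point is determined by the values of the homogeneous fractions. -/
theorem ext_val {P Q : FieldPoint 𝒜 F}
    (h : ∀ m, ∀ a ∈ 𝒜 m, ∀ b ∈ 𝒜 m, P.val a b = Q.val a b) : P = Q := by
  have h1 : P.1 = Q.1 := by
    apply ProjectiveSpectrum.ext
    apply HomogeneousIdeal.ext'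
    intro i x hx
    have h2 := P.mem_prime_iff hx
    have h3 := Q.mem_prime_iff hx
    rw [h i x hx x hx] at h2
    exact h2.trans h3.symm
  obtain ⟨x, f, hf⟩ := P
  obtain ⟨y, g, hg⟩ := Q
  obtain rfl : x = y := h1
  congr 1
  apply Subtype.ext
  refine RingHom.ext fun c => ?_
  obtain ⟨⟨m, ⟨a, ha⟩, ⟨b, hb⟩, hc⟩, rfl⟩ := HomogeneousLocalization.mk_surjective c
  have h4 := h m a ha b hb
  rwa [val_eq ⟨x, f, hf⟩ ha hb hc, val_eq ⟨x, g, hg⟩ ha hb hc] at h4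

theorem exists_pos_degree_notMem (P : FieldPoint 𝒜 F) :
    ∃ m, 0 < m ∧ ∃ s ∈ 𝒜 m, s ∉ P.prime := by
  classical
  by_contra! h
  apply P.1.not_irrelevant_le
  intro a ha
  change a ∈ P.prime
  rw [← DirectSum.sum_support_decompose 𝒜 a]
  refine Ideal.sum_mem _ fun i _ => ?_
  by_cases hi : i = 0
  · subst hi
    have : (DirectSum.decompose 𝒜 a 0 : A) = 0 := (HomogeneousIdeal.mem_irrelevant_iff 𝒜 a).1 ha
    rw [this]
    exact zero_mem _
  · exact h i (Nat.pos_of_ne_zero hi) _ (SetLike.coe_mem _)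

section OfRingHom

variable (Φ : A →+* F)

theorem mem_homogeneousCore_iff {a : A} {m : ℕ} (ha : a ∈ 𝒜 m) :
    a ∈ (RingHom.ker Φ).homogeneousCore 𝒜 ↔ Φ a = 0 :=
  ⟨fun h => Ideal.toIdeal_homogeneousCore_le 𝒜 _ h, fun h =>
    Ideal.mem_homogeneousCore_of_homogeneous_of_mem ⟨m, ha⟩ h⟩

/-- The homogeneous prime of elements all of whose components are killed by `Φ`. -/
def spectrumPointOfRingHom (hΦ : ∃ m, 0 < m ∧ ∃ s ∈ 𝒜 m, Φ s ≠ 0) : ProjectiveSpectrum 𝒜 where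
  asHomogeneousIdeal := (RingHom.ker Φ).homogeneousCore 𝒜
  isPrime := (RingHom.ker_isPrime Φ).homogeneousCore
  not_irrelevant_le h := by
    obtain ⟨m, hm, s, hs, h0⟩ := hΦ
    refine h0 ((mem_homogeneousCore_iff Φ hs).1 (h ?_))
    rw [HomogeneousIdeal.mem_irrelevant_iff, GradedRing.proj_apply,
      DirectSum.decompose_of_mem_ne 𝒜 hs hm.ne']

theorem eq_zero_of_mul_eq_zero {s h : A} {j : ℕ}
    (hs : s ∉ (RingHom.ker Φ).homogeneousCore 𝒜) (hh : h ∈ 𝒜 j) (h0 : s * h = 0) : Φ h = 0 := by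
  classical
  have : ∃ k, Φ (DirectSum.decompose 𝒜 s k : A) ≠ 0 := by
    by_contra! hk
    apply hs
    rw [← DirectSum.sum_support_decompose 𝒜 s]
    exact sum_mem fun i _ =>
      (mem_homogeneousCore_iff Φ (SetLike.coe_mem (DirectSum.decompose 𝒜 s i))).2 (hk i)
  obtain ⟨k, hk⟩ := this
  have h1 := DirectSum.coe_decompose_mul_add_of_right_mem 𝒜 (i := k) (a := s) hh
  rw [h0, DirectSum.decompose_zero, DirectSum.zero_apply, ZeroMemClass.coe_zero] at h1
  have h2 := congrArg Φ h1
  rw [map_zero, map_mul] at h2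
  exact (mul_eq_zero.1 h2.symm).resolve_left hk

/-- The homomorphism `a / b ↦ Φ a / Φ b` on the homogeneous localization. -/
def localizationHom (hΦ : ∃ m, 0 < m ∧ ∃ s ∈ 𝒜 m, Φ s ≠ 0) :
    HomogeneousLocalization.AtPrime 𝒜
      (spectrumPointOfRingHom Φ hΦ).asHomogeneousIdeal.toIdeal →+* F where
  toFun := Quotient.lift (fun c => Φ c.num / Φ c.den) fun c c' h => by
    have hd : Φ c.den ≠ 0 := fun h0 =>
      c.den_mem ((mem_homogeneousCore_iff Φ (SetLike.coe_mem c.den)).2 h0)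
    have hd' : Φ c'.den ≠ 0 := fun h0 =>
      c'.den_mem ((mem_homogeneousCore_iff Φ (SetLike.coe_mem c'.den)).2 h0)
    obtain ⟨s, hs⟩ := (Localization.r_iff_exists.1 (Localization.mk_eq_mk_iff.1 h))
    simp only at hs
    have h1 : (c'.den * c.num - c.den * c'.num : A) ∈ 𝒜 (c.deg + c'.deg) :=
      sub_mem (add_comm c.deg c'.deg ▸ SetLike.mul_mem_graded (SetLike.coe_mem _) (SetLike.coe_mem _))
        (SetLike.mul_mem_graded (SetLike.coe_mem _) (SetLike.coe_mem _))
    have h2 := eq_zero_of_mul_eq_zero (s := s.1) Φ s.2 h1 (by rw [mul_sub, hs, sub_self])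
    rw [map_sub, map_mul, map_mul, sub_eq_zero] at h2
    change Φ c.num / Φ c.den = Φ c'.num / Φ c'.den
    rw [div_eq_div_iff hd hd']
    linear_combination h2
  map_one' := by
    change Φ (1 : A) / Φ (1 : A) = 1
    simp
  map_zero' := by
    change Φ (0 : A) / Φ (1 : A) = 0
    simp
  map_mul' x y := by
    obtain ⟨c, rfl⟩ := HomogeneousLocalization.mk_surjective x
    obtain ⟨c', rfl⟩ := HomogeneousLocalization.mk_surjective y
    change Φ (c.num * c'.num : A) / Φ (c.den * c'.den : A) = Φ c.num / Φ c.den * (Φ c'.num / Φ c'.den)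
    rw [map_mul, map_mul, mul_div_mul_comm]
  map_add' x y := by
    obtain ⟨c, rfl⟩ := HomogeneousLocalization.mk_surjective x
    obtain ⟨c', rfl⟩ := HomogeneousLocalization.mk_surjective y
    have hd : Φ c.den ≠ 0 := fun h0 =>
      c.den_mem ((mem_homogeneousCore_iff Φ (SetLike.coe_mem c.den)).2 h0)
    have hd' : Φ c'.den ≠ 0 := fun h0 =>
      c'.den_mem ((mem_homogeneousCore_iff Φ (SetLike.coe_mem c'.den)).2 h0)
    change Φ (c.den * c'.num + c'.den * c.num : A) / Φ (c.den * c'.den : A) =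
      Φ c.num / Φ c.den + Φ c'.num / Φ c'.den
    rw [map_add, map_mul, map_mul, map_mul]
    field_simp
    ring

/-- The field-valued point of `Proj 𝒜` defined by an (ungraded) ring homomorphism `𝒜 → F` that does
not kill the irrelevant ideal. -/
def ofRingHom (hΦ : ∃ m, 0 < m ∧ ∃ s ∈ 𝒜 m, Φ s ≠ 0) : FieldPoint 𝒜 F :=
  ⟨spectrumPointOfRingHom Φ hΦ, localizationHom Φ hΦ, by
    constructor
    intro x hx
    obtain ⟨c, rfl⟩ := HomogeneousLocalization.mk_surjective x
    have hd : Φ c.den ≠ 0 := fun h0 =>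
      c.den_mem ((mem_homogeneousCore_iff Φ (SetLike.coe_mem c.den)).2 h0)
    have hx' : Φ c.num / Φ c.den ≠ 0 := isUnit_iff_ne_zero.1 hx
    have hn : (c.num : A) ∉ (spectrumPointOfRingHom Φ hΦ).asHomogeneousIdeal.toIdeal := fun h0 =>
      hx' (by rw [(mem_homogeneousCore_iff Φ (SetLike.coe_mem c.num)).1 h0, zero_div])
    refine IsUnit.of_mul_eq_one (HomogeneousLocalization.mk ⟨c.deg, c.den, c.num, hn⟩) ?_
    apply HomogeneousLocalization.val_injective
    rw [HomogeneousLocalization.val_mul, HomogeneousLocalization.val_one,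
      HomogeneousLocalization.val_mk, HomogeneousLocalization.val_mk, Localization.mk_mul,
      ← Localization.mk_one, Localization.mk_eq_mk_iff, Localization.r_iff_exists]
    exact ⟨1, by simp [mul_comm]⟩⟩

theorem val_ofRingHom (hΦ : ∃ m, 0 < m ∧ ∃ s ∈ 𝒜 m, Φ s ≠ 0) {a b : A} {m : ℕ}
    (ha : a ∈ 𝒜 m) (hb : b ∈ 𝒜 m) : (ofRingHom Φ hΦ).val a b = Φ a / Φ b := by
  by_cases h : b ∈ (ofRingHom Φ hΦ).prime
  · rw [val_of_mem _ h, (mem_homogeneousCore_iff Φ hb).1 h, div_zero]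
  · rw [val_eq _ ha hb h]
    rfl

end OfRingHom

end FieldPoint

end FieldPoints

/-! ### Independent sets and lattices of weights -/

section Lattice

variable {n d : ℕ} (a : Fin n → Fin d → ℤ)

/-- The vectors `a i` with label in `S` are linearly independent. -/
abbrev Indep (S : Finset (Fin n)) : Prop := LinearIndependent ℤ fun i : S => a i

/-- The weights of `Tⁿ` that are trivial on `Tᵏ`, i.e. the image of `(𝔱ᵈ)^*` in `(𝔱ⁿ)^*`. -/
abbrev weightLattice : Submodule ℤ (Fin n → ℤ) := LinearMap.range (characterMap a)

/-- The weights in `weightLattice a` whose coordinates with label in `S` vanish. -/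
def faceLattice (S : Finset (Fin n)) : Submodule ℤ (Fin n → ℤ) :=
  weightLattice a ⊓ ⨅ i ∈ S, LinearMap.ker (LinearMap.proj i : (Fin n → ℤ) →ₗ[ℤ] ℤ)

variable {a}

theorem mem_faceLattice {S : Finset (Fin n)} {u : Fin n → ℤ} :
    u ∈ faceLattice a S ↔ u ∈ weightLattice a ∧ ∀ i ∈ S, u i = 0 := by
  simp [faceLattice, Submodule.mem_iInf]

theorem mem_lieKernel {k : Fin n → ℤ} : k ∈ lieKernel a ↔ ∀ j, ∑ i, k i * a i j = 0 := by
  simp [latticeMap, Fintype.linearCombination_apply, funext_iff]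

theorem characterMap_apply (v : Fin d → ℤ) (i : Fin n) : characterMap a v i = ∑ j, v j * a i j := by
  simp [characterMap, Fintype.linearCombination_apply]

theorem sum_mul_eq_zero {k u : Fin n → ℤ} (hk : k ∈ lieKernel a) (hu : u ∈ weightLattice a) :
    ∑ i, k i * u i = 0 := by
  obtain ⟨v, rfl⟩ := hu
  simp only [characterMap_apply, Finset.mul_sum]
  rw [Finset.sum_comm]
  rw [mem_lieKernel] at hk
  refine Finset.sum_eq_zero fun j _ => ?_
  calc ∑ i, k i * (v j * a i j) = v j * ∑ i, k i * a i j := by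
        rw [Finset.mul_sum]; exact Finset.sum_congr rfl fun i _ => by ring
    _ = 0 := by rw [hk, mul_zero]

/-- A dependent set of labels supports a nontrivial relation. -/
theorem exists_relation {S : Finset (Fin n)} (hS : ¬ Indep a S) :
    ∃ k ∈ lieKernel a, (∀ i ∉ S, k i = 0) ∧ ∃ i ∈ S, k i ≠ 0 := by
  classical
  obtain ⟨g, hg, i, hi⟩ := Fintype.not_linearIndependent_iff.1 hS
  refine ⟨fun i => if h : i ∈ S then g ⟨i, h⟩ else 0, ?_, fun i hi => by simp [hi], i, i.2,
    by simpa using hi⟩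
  rw [mem_lieKernel]
  intro j
  have h1 := congrFun hg j
  simp only [Finset.sum_apply, Pi.smul_apply, smul_eq_mul, Pi.zero_apply] at h1
  refine Eq.trans ?_ h1
  rw [← Finset.sum_subset (Finset.subset_univ S)]
  · rw [← Finset.sum_attach S]
    exact Finset.sum_congr rfl fun i _ => by simp
  · intro i _ hi
    simp [hi]

theorem Indep.eq_zero {S : Finset (Fin n)} (hS : Indep a S) {k : Fin n → ℤ}
    (hk : k ∈ lieKernel a) (h : ∀ i ∉ S, k i = 0) : k = 0 := by
  classical
  have h1 := Fintype.linearIndependent_iff.1 hS (fun i => k i) (by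
    funext j
    rw [mem_lieKernel] at hk
    simp only [Finset.sum_apply, Pi.smul_apply, smul_eq_mul, Pi.zero_apply]
    rw [← hk j, ← Finset.sum_subset (Finset.subset_univ S), ← Finset.sum_attach S]
    · rfl
    · intro i _ hi
      simp [h i hi])
  funext i
  by_cases hi : i ∈ S
  · exact h1 ⟨i, hi⟩
  · exact h i hi

/-- Up to a common factor, the coordinates of a weight can be prescribed on an independent set. -/
theorem Indep.exists_weight {S : Finset (Fin n)} (hS : Indep a S) :
    ∃ N : ℕ, 0 < N ∧ ∀ c : Fin n → ℤ, ∃ u ∈ weightLattice a, ∀ i ∈ S, u i = N * c i := by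
  classical
  have hQ : LinearIndependent ℚ fun i : S => fun j => (a i j : ℚ) := by
    rw [← LinearIndependent.iff_fractionRing (R := ℤ)]
    exact hS.map' ((Int.castAddHom ℚ).toIntLinearMap.compLeft (Fin d)) (by
      rw [LinearMap.ker_eq_bot]
      intro x y h
      funext j
      exact Int.cast_injective (α := ℚ) (congrFun h j))
  obtain ⟨g, hg⟩ := LinearMap.exists_leftInverse_of_injective
    (Fintype.linearCombination ℚ fun i : S => fun j => (a i j : ℚ))
    (LinearMap.ker_eq_bot.2 hQ.fintypeLinearCombination_injective)
  obtain ⟨b, hb⟩ := IsLocalization.exist_integer_multiples_of_finite (nonZeroDivisors ℤ)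
    (fun p : Fin d × S => g (Pi.single p.1 1) p.2)
  choose m hm using hb
  have hdual : ∀ i i' : S, ∑ j, m (j, i) * a i' j = if i' = i then (b : ℤ) else 0 := by
    intro i i'
    have h1 := congrFun (LinearMap.congr_fun hg (Pi.single i' 1)) i
    simp only [LinearMap.comp_apply, Fintype.linearCombination_apply_single, one_smul,
      LinearMap.id_apply] at h1
    rw [show (fun j => (a i' j : ℚ)) = ∑ j, (a i' j : ℚ) • Pi.single j (1 : ℚ) by
      funext j; simp [Finset.sum_apply, Pi.single_apply], map_sum] at h1
    simp only [map_smul, Finset.sum_apply, Pi.smul_apply, smul_eq_mul] at h1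
    have h2 : ((∑ j, m (j, i) * a i' j : ℤ) : ℚ) = ((if i' = i then (b : ℤ) else 0 : ℤ) : ℚ) := by
      push_cast
      have : ∀ j, (m (j, i) : ℚ) = (b : ℤ) * g (Pi.single j 1) i := fun j => by
        have := hm (j, i)
        simpa [Submonoid.smul_def] using this
      simp only [this]
      calc ∑ j, ((b : ℤ) : ℚ) * g (Pi.single j 1) i * (a i' j : ℚ)
          = ((b : ℤ) : ℚ) * ∑ j, (a i' j : ℚ) * g (Pi.single j 1) i := by
            rw [Finset.mul_sum]; exact Finset.sum_congr rfl fun j _ => by ring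
        _ = _ := by
          rw [h1, Pi.single_apply]
          by_cases h : i' = i
          · simp [h]
          · simp [h, Ne.symm h]
    exact_mod_cast h2
  have hb0 : (b : ℤ) ≠ 0 := nonZeroDivisors.coe_ne_zero b
  refine ⟨(b : ℤ).natAbs, Int.natAbs_pos.2 hb0, fun c => ?_⟩
  refine ⟨characterMap a (fun j => ∑ i : S, Int.sign b * c i * m (j, i)), ⟨_, rfl⟩, fun i hi => ?_⟩
  rw [characterMap_apply]
  calc ∑ j, (∑ i' : S, Int.sign b * c i' * m (j, i')) * a i j
      = ∑ i' : S, Int.sign b * c i' * ∑ j, m (j, i') * a (⟨i, hi⟩ : S) j := by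
        simp only [Finset.sum_mul, Finset.mul_sum]
        rw [Finset.sum_comm]
        exact Finset.sum_congr rfl fun i' _ => Finset.sum_congr rfl fun j _ => by ring
    _ = Int.sign b * c i * b := by
        rw [Finset.sum_eq_single (⟨i, hi⟩ : S)]
        · rw [hdual, if_pos rfl]
        · intro i' _ h
          rw [hdual, if_neg (Ne.symm h), mul_zero]
        · simp
    _ = _ := by
        rw [mul_right_comm, Int.sign_mul_self_eq_natAbs]

/-- An independent set of labels is contained in a basis `J` of the matroid. For each label `i ∉ J`
there is an elementary relation, which involves `i` and otherwise only labels in `J`. -/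
theorem Indep.exists_basis (hrank : Module.finrank ℤ (LinearMap.range (latticeMap a)) = d)
    {S : Finset (Fin n)} (hS : Indep a S) :
    ∃ J : Finset (Fin n), S ⊆ J ∧ Indep a J ∧ J.card = d ∧
      ∀ i ∉ J, ∃ k ∈ lieKernel a, k i ≠ 0 ∧ ∀ j ∉ J, j ≠ i → k j = 0 := by
  classical
  obtain ⟨J, hSJ, hJ⟩ := Finite.exists_le_maximal (p := Indep a) hS
  have hrel : ∀ i ∉ J, ∃ k ∈ lieKernel a, k i ≠ 0 ∧ ∀ j ∉ J, j ≠ i → k j = 0 := by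
    intro i hi
    have h1 : ¬ Indep a (insert i J) := fun h =>
      hi (hJ.2 h (Finset.subset_insert i J) (Finset.mem_insert_self i J))
    obtain ⟨k, hk, h0, l, -, hl⟩ := exists_relation h1
    refine ⟨k, hk, fun hki => hl ?_, fun j hj hji => h0 j (by simp [hj, hji])⟩
    refine congrFun (hJ.1.eq_zero hk fun j hj => ?_) l
    by_cases hji : j = i
    · rwa [hji]
    · exact h0 j (by simp [hj, hji])
  refine ⟨J, hSJ, hJ.1, le_antisymm ?_ ?_, hrel⟩
  · simpa using hJ.1.fintype_card_le_finrank
  · choose k hk hki hkj using hrel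
    have hli : LinearIndependent ℤ
        (fun i : (Jᶜ : Finset (Fin n)) => (⟨k i (Finset.mem_compl.1 i.2), hk _ _⟩ : lieKernel a)) := by
      rw [Fintype.linearIndependent_iff]
      intro g hg i
      have h1 := congrFun (congrArg Subtype.val hg) (i : Fin n)
      simp only [AddSubmonoidClass.coe_finsetSum, Finset.sum_apply, SetLike.val_smul,
        Pi.smul_apply, smul_eq_mul, ZeroMemClass.coe_zero, Pi.zero_apply] at h1
      rw [Finset.sum_eq_single i] at h1
      · exact (mul_eq_zero.1 h1).resolve_right (hki _ _)
      · intro j _ hji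
        rw [hkj _ _ _ (Finset.mem_compl.1 i.2) (fun h => hji (Subtype.ext h.symm)), mul_zero]
      · simp
    have h1 := hli.fintype_card_le_finrank
    have h2 := (lieKernel a).finrank_quotient_add_finrank
    rw [(latticeMap a).quotKerEquivRange.finrank_eq, hrank, Module.finrank_fin_fun] at h2
    rw [Fintype.card_coe, Finset.card_compl, Fintype.card_fin] at h1
    have h3 := J.card_le_univ
    rw [Fintype.card_fin] at h3
    omega

/-- A weight is determined by its coordinates on a basis. -/
theorem eq_zero_of_forall_mem_basis {J : Finset (Fin n)}
    (hJ : ∀ i ∉ J, ∃ k ∈ lieKernel a, k i ≠ 0 ∧ ∀ j ∉ J, j ≠ i → k j = 0)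
    {u : Fin n → ℤ} (hu : u ∈ weightLattice a) (h : ∀ i ∈ J, u i = 0) : u = 0 := by
  funext i
  by_cases hi : i ∈ J
  · exact h i hi
  obtain ⟨k, hk, hki, hkj⟩ := hJ i hi
  have h1 := sum_mul_eq_zero hk hu
  rw [Finset.sum_eq_single i] at h1
  · exact (mul_eq_zero.1 h1).resolve_left hki
  · intro j _ hj
    by_cases hjJ : j ∈ J
    · rw [h j hjJ, mul_zero]
    · rw [hkj j hjJ hj, zero_mul]
  · simp

theorem Indep.finrank_faceLattice
    (hrank : Module.finrank ℤ (LinearMap.range (latticeMap a)) = d)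
    {S : Finset (Fin n)} (hS : Indep a S) :
    Module.finrank ℤ (faceLattice a S) + S.card = d := by
  classical
  obtain ⟨J, hSJ, hJ, hcard, hrel⟩ := hS.exists_basis hrank
  have hle : Module.finrank ℤ (faceLattice a S) ≤ (J \ S).card := by
    let f : faceLattice a S →ₗ[ℤ] ((J \ S : Finset (Fin n)) → ℤ) :=
      (LinearMap.funLeft ℤ ℤ Subtype.val).comp (faceLattice a S).subtype
    have hf : Function.Injective f := by
      rw [injective_iff_map_eq_zero]
      rintro ⟨u, hu⟩ h
      rw [mem_faceLattice] at hu
      refine Subtype.ext (eq_zero_of_forall_mem_basis hrel hu.1 fun i hi => ?_)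
      by_cases hiS : i ∈ S
      · exact hu.2 i hiS
      · exact congrFun h ⟨i, Finset.mem_sdiff.2 ⟨hi, hiS⟩⟩
    have h := LinearMap.finrank_le_finrank_of_injective hf
    rwa [Module.finrank_fintype_fun_eq_card, Fintype.card_coe] at h
  have hge : (J \ S).card ≤ Module.finrank ℤ (faceLattice a S) := by
    obtain ⟨N, hN, hc⟩ := hJ.exists_weight
    choose u hu huJ using fun i => hc (Pi.single i 1)
    have hli : LinearIndependent ℤ (fun i : (J \ S : Finset (Fin n)) =>
        (⟨u i, mem_faceLattice.2 ⟨hu i, fun j hj => by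
          rw [huJ _ _ (hSJ hj), Pi.single_apply, if_neg, mul_zero]
          rintro rfl
          exact (Finset.mem_sdiff.1 i.2).2 hj⟩⟩ : faceLattice a S)) := by
      rw [Fintype.linearIndependent_iff]
      intro g hg i
      have h1 := congrFun (congrArg Subtype.val hg) (i : Fin n)
      simp only [AddSubmonoidClass.coe_finsetSum, Finset.sum_apply, SetLike.val_smul,
        Pi.smul_apply, smul_eq_mul, ZeroMemClass.coe_zero, Pi.zero_apply,
        huJ _ _ (Finset.mem_sdiff.1 i.2).1] at h1
      rw [Finset.sum_eq_single i] at h1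
      · rw [Pi.single_eq_same, mul_one] at h1
        exact (mul_eq_zero.1 h1).resolve_right (by positivity)
      · intro j _ hji
        rw [Pi.single_apply, if_neg (fun h => hji (Subtype.ext h.symm)), mul_zero, mul_zero]
      · simp
    have h := hli.fintype_card_le_finrank
    rwa [Fintype.card_coe] at h
  rw [le_antisymm hle hge, Finset.card_sdiff_add_card_eq_card hSJ, hcard]

/-- Since `faceLattice a S` is saturated in `weightLattice a`, it is a direct summand. -/
theorem exists_retraction (S : Finset (Fin n)) :
    ∃ π : weightLattice a →ₗ[ℤ] faceLattice a S,
      ∀ u (hu : u ∈ faceLattice a S), π ⟨u, (mem_faceLattice.1 hu).1⟩ = ⟨u, hu⟩ := by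
  let f : weightLattice a →ₗ[ℤ] (S → ℤ) :=
    (LinearMap.funLeft ℤ ℤ Subtype.val).comp (weightLattice a).subtype
  obtain ⟨s, hs⟩ := Module.projective_lifting_property f.rangeRestrict LinearMap.id
    f.surjective_rangeRestrict
  have hfs : ∀ y : LinearMap.range f, f (s y) = y := fun y =>
    congrArg Subtype.val (LinearMap.congr_fun hs y)
  refine ⟨LinearMap.codRestrict _ ((weightLattice a).subtype.comp
    (LinearMap.id - s.comp f.rangeRestrict)) fun u => ?_, fun u hu => ?_⟩
  · rw [mem_faceLattice]
    refine ⟨SetLike.coe_mem (u - s (f.rangeRestrict u)), fun i hi => ?_⟩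
    have h1 : f (u - s (f.rangeRestrict u)) = 0 := by
      rw [map_sub, hfs, sub_eq_zero]; rfl
    exact congrFun h1 ⟨i, hi⟩
  · apply Subtype.ext
    have h1 : f.rangeRestrict ⟨u, (mem_faceLattice.1 hu).1⟩ = 0 :=
      Subtype.ext (funext fun i : S => (mem_faceLattice.1 hu).2 i i.2)
    simp [h1]

theorem card_faceLattice_hom (S : Finset (Fin n)) (F : Type) [Field F] [Finite F] :
    Finite (faceLattice a S →ₗ[ℤ] Additive Fˣ) ∧
    Nat.card (faceLattice a S →ₗ[ℤ] Additive Fˣ) =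
      (Nat.card F - 1) ^ Module.finrank ℤ (faceLattice a S) := by
  have e := ((Module.finBasis ℤ (faceLattice a S)).constr (M' := Additive Fˣ) ℤ).toEquiv
  refine ⟨Finite.of_equiv _ e, ?_⟩
  rw [← Nat.card_congr e, Nat.card_fun, Nat.card_fin]
  congr 1
  rw [← Nat.card_units]
  exact Nat.card_congr Additive.toMul

end Lattice

/-! ### The values of the products `z_i * w_i` in large characteristic -/

section LargeCharacteristic

open Filter

variable {n d : ℕ} {a : Fin n → Fin d → ℤ} {lam : lieKernel a →ₗ[ℤ] ℤ}

/-- The affine space of possible values `(z_i w_i)_i` at the `F`-points of `μ⁻¹(lam)`. -/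
def productSpace (a : Fin n → Fin d → ℤ) (lam : lieKernel a →ₗ[ℤ] ℤ) (F : Type) [Field F] :
    Set (Fin n → F) :=
  {x | ∀ k : lieKernel a, ∑ i, (k.1 i : F) * x i = (lam k : F)}

/-- For a regular value `lam`, every dependent set of labels supports a relation on which `lam` does
not vanish. Otherwise `lam` extends to a functional on `ℂⁿ` vanishing on these coordinates, and
there is a point of the fibre with `z_i = w_i = 0` for all these labels, where the differential of
the moment map vanishes on the relations that they support. -/
theorem IsRegularValue.exists_relation (hlam : IsRegularValue a lam) {S : Finset (Fin n)}
    (hS : ¬ Indep a S) : ∃ k : lieKernel a, (∀ i ∉ S, k.1 i = 0) ∧ lam k ≠ 0 := by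
  classical
  by_contra! h0
  let f : lieKernel a →ₗ[ℤ] (Fin n → ℤ) :=
    (LinearMap.pi fun i => if i ∈ S then 0 else LinearMap.proj i).comp (lieKernel a).subtype
  have hf : ∀ k i, f k i = if i ∈ S then 0 else k.1 i := fun k i => by
    simp only [f, LinearMap.comp_apply, LinearMap.pi_apply]
    split_ifs <;> rfl
  let g : lieKernel a →ₗ[ℤ] ℂ := (Int.castAddHom ℂ).toIntLinearMap.comp lam
  have hfg : LinearMap.ker f ≤ LinearMap.ker g := fun k hk => by
    have h1 := h0 k fun i hi => by
      have h2 := congrFun (LinearMap.mem_ker.1 hk) i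
      rwa [hf, if_neg hi] at h2
    simp [g, h1]
  let : DivisibleBy ℂ ℤ := inferInstance
  obtain ⟨h, hh⟩ := Module.Baer.extension_property (Module.Baer.of_divisible ℂ)
    ((LinearMap.ker f).liftQ f le_rfl)
    (LinearMap.ker_eq_bot.1 (Submodule.ker_liftQ_eq_bot _ _ _ le_rfl))
    ((LinearMap.ker f).liftQ g hfg)
  have hh' : ∀ k, h (f k) = (lam k : ℂ) := fun k =>
    LinearMap.congr_fun hh (Submodule.Quotient.mk k)
  obtain ⟨k, hk, hkS, i₀, hi₀, hki₀⟩ := Hypertoric.exists_relation hS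
  obtain ⟨z', w', hzw⟩ := hlam (fun i => if i ∈ S then 0 else h (Pi.single i 1))
    (fun i => if i ∈ S then 0 else 1) (fun k => by
      rw [← hh' k, ← Finset.univ_sum_single (f k), map_sum]
      simp only [momentMap, LinearMap.coe_mk, AddHom.coe_mk]
      refine Finset.sum_congr rfl fun i _ => ?_
      rw [hf]
      split_ifs
      · simp
      · rw [mul_one, ← zsmul_eq_mul, ← map_zsmul, ← Pi.single_smul, smul_eq_mul, mul_one])
    ((Int.castAddHom ℂ).toIntLinearMap.comp ((LinearMap.proj i₀).comp (lieKernel a).subtype))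
  have h1 := LinearMap.congr_fun hzw ⟨k, hk⟩
  apply hki₀
  apply Int.cast_injective (α := ℂ)
  rw [Int.cast_zero]
  refine h1.symm.trans ?_
  simp only [momentMapDifferential, momentMap, LinearMap.coe_mk, AddHom.coe_mk,
    LinearMap.add_apply, ← Finset.sum_add_distrib]
  refine Finset.sum_eq_zero fun i _ => ?_
  by_cases hi : i ∈ S
  · simp [hi]
  · simp [hkS i hi]

theorem eventually_intCast_ne_zero {D : ℤ} (hD : D ≠ 0) :
    ∀ᶠ p : ℕ in atTop, ∀ (F : Type) [Field F], ringChar F = p → (D : F) ≠ 0 := by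
  filter_upwards [eventually_gt_atTop D.natAbs] with p hp F _ hF h0
  have h1 := (CharP.intCast_eq_zero_iff F (ringChar F) D).1 h0
  have h2 := Nat.le_of_dvd (Int.natAbs_pos.2 hD) (Int.natCast_dvd.1 h1)
  omega

theorem eventually_indep (hlam : IsRegularValue a lam) :
    ∀ᶠ p : ℕ in atTop, ∀ (F : Type) [Field F], ringChar F = p →
      ∀ x ∈ productSpace a lam F, ∀ S : Finset (Fin n), (∀ i ∈ S, x i = 0) → Indep a S := by
  have h : ∀ S : Finset (Fin n), ∀ᶠ p : ℕ in atTop, ∀ (F : Type) [Field F], ringChar F = p →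
      ∀ x ∈ productSpace a lam F, (∀ i ∈ S, x i = 0) → Indep a S := by
    intro S
    by_cases hS : Indep a S
    · exact Eventually.of_forall fun p F _ _ x _ _ => hS
    obtain ⟨k, hk, hlk⟩ := hlam.exists_relation hS
    filter_upwards [eventually_intCast_ne_zero hlk] with p hp F _ hF x hx hxS
    refine absurd ?_ (hp F hF)
    rw [← hx k]
    refine Finset.sum_eq_zero fun i _ => ?_
    by_cases hi : i ∈ S
    · rw [hxS i hi, mul_zero]
    · rw [hk i hi, Int.cast_zero, zero_mul]
  filter_upwards [eventually_all.2 h] with p hp F _ hF x hx S hS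
  exact hp S F hF x hx hS

/-- In large characteristic the coordinates in a basis `J` of the matroid are affine coordinates on
`productSpace a lam F`. The coordinate with label `i ∉ J` is found from the elementary relation
`k i`, and every relation is a combination of these, up to the factor `∏ i, k i i`. -/
theorem eventually_card_productSpace
    (hrank : Module.finrank ℤ (LinearMap.range (latticeMap a)) = d) :
    ∀ᶠ p : ℕ in atTop, ∀ (F : Type) [Field F] [Finite F], ringChar F = p →
      ∀ S : Finset (Fin n), Indep a S →
        Nat.card {x : Fin n → F // x ∈ productSpace a lam F ∧ ∀ i ∈ S, x i = 0} =
          Nat.card F ^ (d - S.card) := by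
  classical
  have h : ∀ S : Finset (Fin n), ∀ᶠ p : ℕ in atTop, ∀ (F : Type) [Field F] [Finite F],
      ringChar F = p → Indep a S →
        Nat.card {x : Fin n → F // x ∈ productSpace a lam F ∧ ∀ i ∈ S, x i = 0} =
          Nat.card F ^ (d - S.card) := by
    intro S
    by_cases hS : Indep a S
    swap
    · exact Eventually.of_forall fun p F _ _ _ h => absurd h hS
    obtain ⟨J, hSJ, hJ, hcard, hrel⟩ := hS.exists_basis hrank
    choose! k hk hki hkj using hrel
    filter_upwards [eventually_all.2 fun i : {i // i ∉ J} =>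
      eventually_intCast_ne_zero (hki i i.2)] with p hp F _ _ hF _
    have hkF : ∀ i ∉ J, ((k i i : ℤ) : F) ≠ 0 := fun i hi => hp ⟨i, hi⟩ F hF
    -- the elementary relations determine the coordinates outside `J`
    have hsplit : ∀ (x : Fin n → F) (i) (_ : i ∉ J),
        ∑ j, (k i j : F) * x j = (k i i : F) * x i + ∑ j ∈ J, (k i j : F) * x j := by
      intro x i hi
      rw [← Finset.sum_subset (Finset.subset_univ (insert i J)), Finset.sum_insert hi]
      intro j _ hj
      simp only [Finset.mem_insert, not_or] at hj
      rw [hkj i hi j hj.2 hj.1, Int.cast_zero, zero_mul]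
    -- it suffices to check the elementary relations
    have hmem : ∀ x : Fin n → F,
        (∀ i (hi : i ∉ J), ∑ j, (k i j : F) * x j = (lam ⟨k i, hk i hi⟩ : F)) →
        x ∈ productSpace a lam F := by
      intro x hx l
      let D : ℤ := ∏ i ∈ Jᶜ, k i i
      let D' : Fin n → ℤ := fun i => ∏ j ∈ Jᶜ.erase i, k j j
      have hD : ∀ i ∈ Jᶜ, k i i * D' i = D := fun i hi =>
        Finset.mul_prod_erase _ (fun j => k j j) hi
      have hDF : (D : F) ≠ 0 := by
        rw [Int.cast_prod]
        exact Finset.prod_ne_zero_iff.2 fun i hi => hkF i (Finset.mem_compl.1 hi)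
      have hlin : D • l = ∑ i : (Jᶜ : Finset (Fin n)),
          (D' i * l.1 i) • (⟨k i, hk i (Finset.mem_compl.1 i.2)⟩ : lieKernel a) := by
        rw [← sub_eq_zero]
        apply Subtype.ext
        refine hJ.eq_zero (SetLike.coe_mem _) fun i hi => ?_
        simp only [AddSubgroupClass.coe_sub, SetLike.val_smul, AddSubmonoidClass.coe_finsetSum,
          Pi.sub_apply, Pi.smul_apply, smul_eq_mul, Finset.sum_apply]
        rw [Finset.sum_eq_single ⟨i, Finset.mem_compl.2 hi⟩]
        · rw [← hD i (Finset.mem_compl.2 hi)]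
          ring
        · intro j _ hji
          rw [hkj j (Finset.mem_compl.1 j.2) i hi (fun h => hji (Subtype.ext h.symm)), mul_zero]
        · simp
      apply mul_left_cancel₀ hDF
      have h1 : ((lam (D • l) : ℤ) : F) = D * lam l := by
        rw [map_smul, smul_eq_mul, Int.cast_mul]
      have h2 : ∑ i, (((D • l).1 i : ℤ) : F) * x i = D * ∑ i, (l.1 i : F) * x i := by
        rw [Finset.mul_sum]
        exact Finset.sum_congr rfl fun i _ => by simp [mul_assoc]
      rw [← h1, ← h2, hlin]
      simp only [map_sum, map_smul, AddSubmonoidClass.coe_finsetSum, SetLike.val_smul,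
        Finset.sum_apply, Pi.smul_apply, smul_eq_mul, Int.cast_sum, Int.cast_mul,
        ← hx _ (Finset.mem_compl.1 (Subtype.prop _)), Finset.sum_mul, Finset.mul_sum]
      rw [Finset.sum_comm]
      exact Finset.sum_congr rfl fun i _ => Finset.sum_congr rfl fun j _ => by ring
    let φ : {x : Fin n → F // x ∈ productSpace a lam F ∧ ∀ i ∈ S, x i = 0} →
        ((J \ S : Finset (Fin n)) → F) := fun x i => x.1 i
    have hφ : Function.Bijective φ := by
      constructor
      · rintro ⟨x, hx, hxS⟩ ⟨y, hy, hyS⟩ hxy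
        have hJxy : ∀ i ∈ J, x i = y i := fun i hi => by
          by_cases hiS : i ∈ S
          · rw [hxS i hiS, hyS i hiS]
          · exact congrFun hxy ⟨i, Finset.mem_sdiff.2 ⟨hi, hiS⟩⟩
        refine Subtype.ext (funext fun i => ?_)
        by_cases hi : i ∈ J
        · exact hJxy i hi
        have h1 := (hx ⟨k i, hk i hi⟩).trans (hy ⟨k i, hk i hi⟩).symm
        rw [hsplit x i hi, hsplit y i hi,
          Finset.sum_congr rfl fun j hj => by rw [hJxy j hj], add_left_inj] at h1
        exact mul_left_cancel₀ (hkF i hi) h1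
      · intro y
        let y' : Fin n → F := fun i => if h : i ∈ J \ S then y ⟨i, h⟩ else 0
        let x : Fin n → F := fun i => if h : i ∈ J then y' i else
          ((k i i : ℤ) : F)⁻¹ * ((lam ⟨k i, hk i h⟩ : F) - ∑ j ∈ J, (k i j : F) * y' j)
        have hxJ : ∀ i ∈ J, x i = y' i := fun i hi => dif_pos hi
        refine ⟨⟨x, hmem x fun i hi => ?_, fun i hi => ?_⟩, funext fun i => ?_⟩
        · rw [hsplit x i hi, Finset.sum_congr rfl fun j hj => by rw [hxJ j hj]]
          simp only [x, dif_neg hi]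
          rw [mul_inv_cancel_left₀ (hkF i hi), sub_add_cancel]
        · rw [hxJ i (hSJ hi)]
          exact dif_neg fun h => (Finset.mem_sdiff.1 h).2 hi
        · exact (hxJ i (Finset.mem_sdiff.1 i.2).1).trans (dif_pos i.2)
    rw [Nat.card_congr (Equiv.ofBijective φ hφ), Nat.card_fun, Nat.card_eq_fintype_card (α := (J \ S : Finset (Fin n))),
      Fintype.card_coe, Finset.card_sdiff_of_subset hSJ, hcard]
  filter_upwards [eventually_all.2 h] with p hp F _ _ hF S hS
  exact hp S F hF hS

end LargeCharacteristic

/-! ### Semi-invariant monomials and homomorphisms to a field -/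

section Monomials

theorem prod_single {R M ι : Type*} [CommSemiring R] [AddCommMonoid M] (T : Finset ι) (u : ι → M)
    (f : ι → R) : ∏ i ∈ T, AddMonoidAlgebra.single (u i) (f i) =
      AddMonoidAlgebra.single (∑ i ∈ T, u i) (∏ i ∈ T, f i) := by
  classical
  induction T using Finset.induction_on with
  | empty => simp [AddMonoidAlgebra.one_def]
  | insert i T hi ih =>
    rw [Finset.prod_insert hi, Finset.sum_insert hi, Finset.prod_insert hi, ih,
      AddMonoidAlgebra.single_mul_single]

variable {n d : ℕ} {a : Fin n → Fin d → ℤ} {lam : lieKernel a →ₗ[ℤ] ℤ}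

/-- The exponents `(p, s, m)` of the monomials `z ^ p * w ^ s * t ^ m`. -/
abbrev Exponent (n : ℕ) : Type := (Fin n → ℕ) × (Fin n → ℕ) × ℕ

/-- The weight `p - s - m r` of the monomial `z ^ p * w ^ s * t ^ m`, where `t` has the weight
`-r`. -/
def weight (r : Fin n → ℤ) : Exponent n →+ (Fin n → ℤ) where
  toFun q i := (q.1 i : ℤ) - q.2.1 i - q.2.2 * r i
  map_zero' := by funext i; simp
  map_add' q q' := by funext i; simp; ring

theorem weight_apply (r : Fin n → ℤ) (q : Exponent n) (i : Fin n) :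
    weight r q i = (q.1 i : ℤ) - q.2.1 i - q.2.2 * r i := rfl

/-- The exponents of the monomials that are semi-invariant, the monomial `z ^ p * w ^ s * t ^ m` being
of weight `α ^ m`. -/
def semiInvariantExponents (a : Fin n → Fin d → ℤ) (r : Fin n → ℤ) : AddSubmonoid (Exponent n) :=
  (weightLattice a).toAddSubmonoid.comap (weight r)

theorem mem_semiInvariantExponents {r : Fin n → ℤ} {q : Exponent n} :
    q ∈ semiInvariantExponents a r ↔ weight r q ∈ weightLattice a := Iff.rfl

variable (a lam) in
/-- The function `z_i` (for `Sum.inl i`) or `w_i` (for `Sum.inr i`) on `μ⁻¹(lam)`. -/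
def coord (i : Fin n ⊕ Fin n) : FiberRing a lam :=
  Ideal.Quotient.mk (fiberIdeal a lam) (MvPolynomial.X i)

variable (a lam) in
/-- The monomial function `z ^ p * w ^ s` on `μ⁻¹(lam)`. -/
def coordMonomial (p s : Fin n → ℕ) : FiberRing a lam :=
  ∏ i, (coord a lam (Sum.inl i) ^ p i * coord a lam (Sum.inr i) ^ s i)

theorem coordMonomial_mul (p s p' s' : Fin n → ℕ) :
    coordMonomial a lam p s * coordMonomial a lam p' s' =
      coordMonomial a lam (p + p') (s + s') := by
  simp only [coordMonomial, ← Finset.prod_mul_distrib, Pi.add_apply, pow_add]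
  exact Finset.prod_congr rfl fun i _ => by ring

theorem mk_monomial (e : Fin n ⊕ Fin n →₀ ℕ) (c : ℤ) :
    Ideal.Quotient.mk (fiberIdeal a lam) (MvPolynomial.monomial e c) =
      c • coordMonomial a lam (fun i => e (Sum.inl i)) (fun i => e (Sum.inr i)) := by
  rw [MvPolynomial.monomial_eq, Finsupp.prod_fintype _ _ (fun i => by simp),
    Fintype.prod_sum_type, map_mul, map_mul, map_prod, map_prod]
  simp only [map_pow, coordMonomial, Finset.prod_mul_distrib, coord, zsmul_eq_mul]
  congr 1

theorem coaction_coordMonomial (p s : Fin n → ℕ) :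
    coaction a lam (coordMonomial a lam p s) =
      AddMonoidAlgebra.single (restrictCharacter a fun i => (p i : ℤ) - s i)
        (coordMonomial a lam p s) := by
  classical
  have hz : ∀ i, coaction a lam (coord a lam (Sum.inl i)) =
      AddMonoidAlgebra.single (restrictCharacter a (Pi.single i 1)) (coord a lam (Sum.inl i)) := by
    intro i
    refine (Ideal.Quotient.lift_mk _ _ _).trans ?_
    simp [coord]
  have hw : ∀ i, coaction a lam (coord a lam (Sum.inr i)) =
      AddMonoidAlgebra.single (-restrictCharacter a (Pi.single i 1)) (coord a lam (Sum.inr i)) := by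
    intro i
    refine (Ideal.Quotient.lift_mk _ _ _).trans ?_
    simp [coord]
  rw [coordMonomial, map_prod]
  simp only [map_mul, map_pow, hz, hw, AddMonoidAlgebra.single_pow,
    AddMonoidAlgebra.single_mul_single]
  rw [prod_single]
  congr 1
  have : (fun i => (p i : ℤ) - s i) =
      ∑ i, (p i • Pi.single i (1 : ℤ) + s i • -Pi.single i (1 : ℤ) : Fin n → ℤ) := by
    funext j
    simp [Finset.sum_apply, Pi.single_apply, Finset.sum_add_distrib, sub_eq_add_neg]
  rw [this]
  change _ = (LinearMap.range (characterMap a)).mkQ _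
  simp only [map_sum, map_add, map_nsmul, map_neg]
  rfl

theorem restrictCharacter_eq_iff {r : Fin n → ℤ} {p s : Fin n → ℕ} {m : ℕ} :
    (restrictCharacter a fun i => (p i : ℤ) - s i) = m • restrictCharacter a r ↔
      ((p, s, m) : Exponent n) ∈ semiInvariantExponents a r := by
  rw [restrictCharacter, restrictCharacter, ← Submodule.Quotient.mk_smul, Submodule.Quotient.eq,
    mem_semiInvariantExponents]
  have : weight r (p, s, m) = (fun i => (p i : ℤ) - s i) - m • r := by
    funext i
    simp [weight_apply]
  rw [this]

theorem coordMonomial_mem_semiInvariants {r : Fin n → ℤ} {p s : Fin n → ℕ} {m : ℕ}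
    (h : ((p, s, m) : Exponent n) ∈ semiInvariantExponents a r) :
    coordMonomial a lam p s ∈ semiInvariants a r lam m := by
  change coaction a lam _ = _
  rw [coaction_coordMonomial, restrictCharacter_eq_iff.2 h]

/-- The semi-invariants are the integral combinations of semi-invariant monomials: the coaction is
diagonal on monomials, and comparing the coefficients of the character `α ^ m` discards the monomials
of another weight. -/
theorem semiInvariants_le_closure (r : Fin n → ℤ) (m : ℕ) :
    semiInvariants a r lam m ≤ AddSubgroup.closure
      {f | ∃ p s, ((p, s, m) : Exponent n) ∈ semiInvariantExponents a r ∧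
        f = coordMonomial a lam p s} := by
  classical
  intro f hf
  change coaction a lam f = _ at hf
  obtain ⟨P, hP⟩ := Ideal.Quotient.mk_surjective f
  have hsum : f = ∑ e ∈ P.support, P.coeff e •
      coordMonomial a lam (fun i => e (Sum.inl i)) (fun i => e (Sum.inr i)) := by
    rw [← hP]
    conv_lhs => rw [P.as_sum, map_sum]
    exact Finset.sum_congr rfl fun e _ => mk_monomial e _
  have h1 : f = (coaction a lam f).coeff (m • restrictCharacter a r) := by
    rw [hf]
    simp
  rw [h1, hsum, map_sum, AddMonoidAlgebra.coeff_sum, Finsupp.finsetSum_apply]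
  refine AddSubgroup.sum_mem _ fun e _ => ?_
  rw [map_zsmul, coaction_coordMonomial, AddMonoidAlgebra.coeff_smul, Finsupp.smul_apply,
    AddMonoidAlgebra.coeff_single, Finsupp.single_apply]
  refine AddSubgroup.zsmul_mem _ ?_ _
  split_ifs with h
  · exact AddSubgroup.subset_closure ⟨_, _, restrictCharacter_eq_iff.1 h, rfl⟩
  · exact zero_mem _

variable (lam) in
/-- The monomial `z ^ p * w ^ s * t ^ m` in the ring of semi-invariants. -/
def semiMonomial {r : Fin n → ℤ} (q : semiInvariantExponents a r) : semiInvariantRing a r lam :=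
  ⟨Polynomial.monomial q.1.2.2 (coordMonomial a lam q.1.1 q.1.2.1), fun j => by
    rw [Polynomial.coeff_monomial]
    split_ifs with h
    · subst h
      exact coordMonomial_mem_semiInvariants q.2
    · exact zero_mem _⟩

variable {r : Fin n → ℤ}

theorem semiMonomial_mem (q : semiInvariantExponents a r) :
    semiMonomial lam q ∈ semiInvariantGrading a r lam q.1.2.2 := fun j hj => by
  simp [semiMonomial, Polynomial.coeff_monomial, hj.symm]

theorem semiMonomial_mem_of_eq (q : semiInvariantExponents a r) {m : ℕ} (h : q.1.2.2 = m) :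
    semiMonomial lam q ∈ semiInvariantGrading a r lam m := h ▸ semiMonomial_mem q

theorem semiMonomial_add (q q' : semiInvariantExponents a r) :
    semiMonomial lam (q + q') = semiMonomial lam q * semiMonomial lam q' := by
  apply Subtype.ext
  change Polynomial.monomial (q.1.2.2 + q'.1.2.2) (coordMonomial a lam (q.1.1 + q'.1.1)
    (q.1.2.1 + q'.1.2.1)) = Polynomial.monomial _ _ * Polynomial.monomial _ _
  rw [Polynomial.monomial_mul_monomial, coordMonomial_mul]

theorem semiMonomial_zero : semiMonomial lam (0 : semiInvariantExponents a r) = 1 := by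
  apply Subtype.ext
  change Polynomial.monomial 0 (coordMonomial a lam 0 0) = 1
  simp [coordMonomial]

theorem semiInvariantGrading_le_closure (m : ℕ) :
    semiInvariantGrading a r lam m ≤ AddSubgroup.closure
      {f | ∃ q : semiInvariantExponents a r, q.1.2.2 = m ∧ f = semiMonomial lam q} := by
  intro f hf
  have h1 := semiInvariants_le_closure r m (f.2 m)
  have h2 : f.1 = Polynomial.monomial m (f.1.coeff m) := by
    ext1 j
    rw [Polynomial.coeff_monomial]
    split_ifs with h
    · rw [h]
    · exact hf j (Ne.symm h)
  have h3 : ∀ c ∈ AddSubgroup.closure {f | ∃ p s, ((p, s, m) : Exponent n) ∈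
      semiInvariantExponents a r ∧ f = coordMonomial a lam p s},
      ∃ g ∈ AddSubgroup.closure {f | ∃ q : semiInvariantExponents a r, q.1.2.2 = m ∧
        f = semiMonomial lam q}, g.1 = Polynomial.monomial m c := by
    intro c hc
    induction hc using AddSubgroup.closure_induction with
    | mem c hc =>
      obtain ⟨p, s, hq, rfl⟩ := hc
      exact ⟨semiMonomial lam ⟨_, hq⟩, AddSubgroup.subset_closure ⟨⟨_, hq⟩, rfl, rfl⟩, rfl⟩
    | zero => exact ⟨0, zero_mem _, by simp⟩
    | add x y _ _ hx hy =>
      obtain ⟨g, hg, hgx⟩ := hx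
      obtain ⟨g', hg', hgy⟩ := hy
      exact ⟨g + g', add_mem hg hg', by simp [hgx, hgy]⟩
    | neg x _ hx =>
      obtain ⟨g, hg, hgx⟩ := hx
      exact ⟨-g, neg_mem hg, by simp [hgx]⟩
  obtain ⟨g, hg, hgf⟩ := h3 _ h1
  rwa [Subtype.ext (h2.trans hgf.symm)]

variable {F : Type} [Field F]

/-- The value of `z ^ p * w ^ s` at the point `(z, w)`. -/
def evalMonomial (z w : Fin n → F) (q : Exponent n) : F :=
  ∏ i, (z i ^ q.1 i * w i ^ q.2.1 i)

theorem evalMonomial_add (z w : Fin n → F) (q q' : Exponent n) :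
    evalMonomial z w (q + q') = evalMonomial z w q * evalMonomial z w q' := by
  simp only [evalMonomial, ← Finset.prod_mul_distrib, Prod.fst_add, Prod.snd_add, Pi.add_apply,
    pow_add]
  exact Finset.prod_congr rfl fun i _ => by ring

/-- Evaluation at the points of the `Tⁿ`-orbit of an `F`-point `(z, w)` of `μ⁻¹(lam)`: the function
`f` goes to the function `f (t z, t⁻¹ w)` on `Tⁿ`. -/
def orbitHom (z w : Fin n → F) (hzw : z * w ∈ productSpace a lam F) :
    FiberRing a lam →+* AddMonoidAlgebra F (Fin n → ℤ) :=
  Ideal.Quotient.lift (fiberIdeal a lam)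
    (MvPolynomial.eval₂Hom (Int.castRingHom _) (Sum.elim
      (fun i => AddMonoidAlgebra.single (Pi.single i 1) (z i))
      (fun i => AddMonoidAlgebra.single (-Pi.single i 1) (w i)))) (by
    suffices h : fiberIdeal a lam ≤ RingHom.ker
        (MvPolynomial.eval₂Hom (Int.castRingHom (AddMonoidAlgebra F (Fin n → ℤ))) (Sum.elim
        (fun i => AddMonoidAlgebra.single (Pi.single i 1) (z i))
        (fun i => AddMonoidAlgebra.single (-Pi.single i 1) (w i)))) from fun f hf => h hf
    rw [fiberIdeal, Ideal.span_le]
    rintro _ ⟨k, rfl⟩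
    change MvPolynomial.eval₂Hom _ _ _ = 0
    have h0 := congrArg (AddMonoidAlgebra.singleZeroRingHom (R := F) (M := Fin n → ℤ)) (hzw k)
    simp only [momentMap, LinearMap.coe_mk, AddHom.coe_mk, map_sub, map_sum, map_mul,
      map_intCast, eq_intCast, MvPolynomial.coe_eval₂Hom, MvPolynomial.eval₂_X, Sum.elim_inl,
      Sum.elim_inr, AddMonoidAlgebra.single_mul_single, add_neg_cancel] at h0 ⊢
    refine (congrArg (_ - ·) h0.symm).trans (sub_eq_zero.2 ?_)
    refine Finset.sum_congr rfl fun i _ => congrArg (_ * ·) ?_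
    rfl)

theorem orbitHom_coordMonomial (z w : Fin n → F) (hzw : z * w ∈ productSpace a lam F)
    (p s : Fin n → ℕ) (m : ℕ) :
    orbitHom z w hzw (coordMonomial a lam p s) =
      AddMonoidAlgebra.single (fun i => (p i : ℤ) - s i) (evalMonomial z w (p, s, m)) := by
  classical
  have hz : ∀ i, orbitHom z w hzw (coord a lam (Sum.inl i)) =
      AddMonoidAlgebra.single (Pi.single i 1) (z i) := fun i =>
    (Ideal.Quotient.lift_mk _ _ _).trans (by simp)
  have hw : ∀ i, orbitHom z w hzw (coord a lam (Sum.inr i)) =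
      AddMonoidAlgebra.single (-Pi.single i 1) (w i) := fun i =>
    (Ideal.Quotient.lift_mk _ _ _).trans (by simp)
  rw [coordMonomial, map_prod]
  simp only [map_mul, map_pow, hz, hw, AddMonoidAlgebra.single_pow,
    AddMonoidAlgebra.single_mul_single]
  rw [prod_single]
  congr 1
  funext j
  simp [Finset.sum_apply, Pi.single_apply, Finset.sum_add_distrib, sub_eq_add_neg]

/-- `orbitHom`, extended to semi-invariants with the variable `t` going to the character of weight
`-r`. -/
def semiInvariantOrbitHom (z w : Fin n → F) (hzw : z * w ∈ productSpace a lam F) (r : Fin n → ℤ) :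
    semiInvariantRing a r lam →+* AddMonoidAlgebra F (Fin n → ℤ) :=
  (Polynomial.eval₂RingHom (orbitHom z w hzw) (AddMonoidAlgebra.single (-r) 1)).comp
    (semiInvariantRing a r lam).subtype

theorem semiInvariantOrbitHom_semiMonomial (z w : Fin n → F) (hzw : z * w ∈ productSpace a lam F)
    (q : semiInvariantExponents a r) :
    semiInvariantOrbitHom z w hzw r (semiMonomial lam q) =
      AddMonoidAlgebra.single (weight r q) (evalMonomial z w q) := by
  change Polynomial.eval₂ _ _ (Polynomial.monomial _ _) = _
  rw [Polynomial.eval₂_monomial, orbitHom_coordMonomial _ _ _ _ _ q.1.2.2,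
    AddMonoidAlgebra.single_pow, AddMonoidAlgebra.single_mul_single, one_pow, mul_one]
  congr 1
  funext i
  simp [weight_apply, sub_eq_add_neg]

variable (F) in
/-- The inclusion of the group ring of `weightLattice a` in the group ring of `(𝔱ⁿ)^*`. -/
def groupRingInclusion (a : Fin n → Fin d → ℤ) :
    AddMonoidAlgebra F (weightLattice a) →+* AddMonoidAlgebra F (Fin n → ℤ) :=
  AddMonoidAlgebra.mapDomainRingHom F (weightLattice a).subtype.toAddMonoidHom

theorem groupRingInclusion_injective : Function.Injective (groupRingInclusion F a) :=
  AddMonoidAlgebra.mapDomain_injective Subtype.val_injective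

theorem groupRingInclusion_single (u : weightLattice a) (c : F) :
    groupRingInclusion F a (AddMonoidAlgebra.single u c) = AddMonoidAlgebra.single u.1 c := by
  simp [groupRingInclusion]

theorem semiInvariantOrbitHom_mem_range (z w : Fin n → F) (hzw : z * w ∈ productSpace a lam F)
    (f : semiInvariantRing a r lam) :
    semiInvariantOrbitHom z w hzw r f ∈ (groupRingInclusion F a).range := by
  classical
  rw [← DirectSum.sum_support_decompose (semiInvariantGrading a r lam) f, map_sum]
  refine sum_mem fun m _ => ?_
  have h := semiInvariantGrading_le_closure m
    (SetLike.coe_mem (DirectSum.decompose (semiInvariantGrading a r lam) f m))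
  generalize (DirectSum.decompose (semiInvariantGrading a r lam) f m :
    semiInvariantRing a r lam) = g at h
  induction h using AddSubgroup.closure_induction with
  | mem g hg =>
    obtain ⟨q, -, rfl⟩ := hg
    rw [semiInvariantOrbitHom_semiMonomial]
    exact ⟨AddMonoidAlgebra.single ⟨weight r q, q.2⟩ _, groupRingInclusion_single _ _⟩
  | zero => rw [map_zero]; exact zero_mem _
  | add x y _ _ hx hy => rw [map_add]; exact add_mem hx hy
  | neg x _ hx => rw [map_neg]; exact neg_mem hx

/-- The homomorphism from the ring of semi-invariants to `F` given by an `F`-point `(z, w)` of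
`μ⁻¹(lam)` and an `F`-point `χ` of `Tᵈ`, which need not come from an `F`-point of `Tⁿ`. -/
def evalHom (z w : Fin n → F) (hzw : z * w ∈ productSpace a lam F)
    (χ : weightLattice a →ₗ[ℤ] Additive Fˣ) (r : Fin n → ℤ) : semiInvariantRing a r lam →+* F :=
  (AddMonoidAlgebra.lift F F (weightLattice a)
    ((Units.coeHom F).comp (AddMonoidHom.toMultiplicativeLeft χ.toAddMonoidHom))).toRingHom.comp
  ((RingEquiv.ofBijective (groupRingInclusion F a).rangeRestrict
    ⟨fun _ _ h => groupRingInclusion_injective (congrArg Subtype.val h),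
      (groupRingInclusion F a).rangeRestrict_surjective⟩).symm.toRingHom.comp
    ((semiInvariantOrbitHom z w hzw r).codRestrict (groupRingInclusion F a).range
      (semiInvariantOrbitHom_mem_range z w hzw)))

theorem evalHom_semiMonomial (z w : Fin n → F) (hzw : z * w ∈ productSpace a lam F)
    (χ : weightLattice a →ₗ[ℤ] Additive Fˣ) (q : semiInvariantExponents a r) :
    evalHom z w hzw χ r (semiMonomial lam q) =
      ((χ ⟨weight r q, q.2⟩).toMul : Fˣ) * evalMonomial z w q := by
  have h1 : (RingEquiv.ofBijective (groupRingInclusion F a).rangeRestrict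
      ⟨fun _ _ h => groupRingInclusion_injective (congrArg Subtype.val h),
      (groupRingInclusion F a).rangeRestrict_surjective⟩).symm
        ((semiInvariantOrbitHom z w hzw r).codRestrict (groupRingInclusion F a).range
      (semiInvariantOrbitHom_mem_range z w hzw) (semiMonomial lam q)) =
      AddMonoidAlgebra.single ⟨weight r q, q.2⟩ (evalMonomial z w q) := by
    rw [RingEquiv.symm_apply_eq]
    apply Subtype.ext
    exact (semiInvariantOrbitHom_semiMonomial z w hzw q).trans
      (groupRingInclusion_single (a := a) ⟨weight r q, q.2⟩ _).symm
  refine (congrArg (AddMonoidAlgebra.lift F F (weightLattice a) _) h1).trans ?_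
  rw [ AddMonoidAlgebra.lift_single, smul_eq_mul, mul_comm]
  rfl

end Monomials

/-! ### Normal forms -/

section NormalForms

variable {n d : ℕ} {a : Fin n → Fin d → ℤ} {lam : lieKernel a →ₗ[ℤ] ℤ} {F : Type} [Field F]
  {r : Fin n → ℤ}

/-- Each pair `(z i, w i)` is of the form `(1, y)`, `(0, 1)` or `(0, 0)`. The torus `Tⁿ` brings every
pair to exactly one of these. -/
def IsNormalized (z w : Fin n → F) : Prop := ∀ i, z i = 1 ∨ (z i = 0 ∧ (w i = 0 ∨ w i = 1))

open Classical in
/-- The labels `i` with `z i = w i = 0`. -/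
def zeroSet (z w : Fin n → F) : Finset (Fin n) := Finset.univ.filter fun i => z i = 0 ∧ w i = 0

theorem mem_zeroSet {z w : Fin n → F} {i : Fin n} : i ∈ zeroSet z w ↔ z i = 0 ∧ w i = 0 := by
  simp [zeroSet]

/-- A monomial with these exponents does not vanish at `(z, w)`. -/
def IsSupported (z w : Fin n → F) (q : Exponent n) : Prop :=
  ∀ i, (z i = 0 → q.1 i = 0) ∧ (w i = 0 → q.2.1 i = 0)

theorem evalMonomial_ne_zero_iff {z w : Fin n → F} {q : Exponent n} :
    evalMonomial z w q ≠ 0 ↔ IsSupported z w q := by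
  simp only [evalMonomial, Finset.prod_ne_zero_iff, IsSupported, Finset.mem_univ, forall_true_left,
    mul_ne_zero_iff, ne_eq, pow_eq_zero_iff', not_and, not_not]

theorem IsSupported.add {z w : Fin n → F} {q q' : Exponent n} (h : IsSupported z w q)
    (h' : IsSupported z w q') : IsSupported z w (q + q') := fun i =>
  ⟨fun hi => by simp [(h i).1 hi, (h' i).1 hi], fun hi => by simp [(h i).2 hi, (h' i).2 hi]⟩

theorem IsSupported.nsmul {z w : Fin n → F} {q : Exponent n} (h : IsSupported z w q) (K : ℕ) :
    IsSupported z w (K • q) := fun i =>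
  ⟨fun hi => by simp [(h i).1 hi], fun hi => by simp [(h i).2 hi]⟩

/-- The monomial has positive degree, and it involves exactly the coordinates that do not vanish at
`(z, w)`. -/
structure IsGeneric (z w : Fin n → F) (q : Exponent n) : Prop where
  isSupported : IsSupported z w q
  degree_pos : 0 < q.2.2
  left_pos : ∀ i, z i ≠ 0 → 0 < q.1 i
  right_pos : ∀ i, w i ≠ 0 → 0 < q.2.1 i

/-- Every point with values in `productSpace a lam F` has a generic monomial, which means that it is
semistable: the signs of the weight can be prescribed on the independent set of the labels
with `z i * w i = 0`. -/
theorem exists_isGeneric {z w : Fin n → F} (h : ∀ S : Finset (Fin n), (∀ i ∈ S, (z * w) i = 0) →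
    Indep a S) (r : Fin n → ℤ) : ∃ q ∈ semiInvariantExponents a r, IsGeneric z w q := by
  classical
  obtain ⟨N, hN, hc⟩ := (h (Finset.univ.filter fun i => (z * w) i = 0) (by simp)).exists_weight
  obtain ⟨u, hu, huJ⟩ := hc fun i => (if z i ≠ 0 then 1 else 0) - (if w i ≠ 0 then 1 else 0) - r i
  have huJ' : ∀ i, z i = 0 ∨ w i = 0 → u i + N * r i =
      N * ((if z i ≠ 0 then 1 else 0) - (if w i ≠ 0 then 1 else 0)) := fun i hi => by
    rw [huJ i (by simpa using hi)]
    ring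
  refine ⟨(fun i => (u i + N * r i).toNat + if z i ≠ 0 ∧ w i ≠ 0 then 1 else 0,
    fun i => (-(u i + N * r i)).toNat + if z i ≠ 0 ∧ w i ≠ 0 then 1 else 0, N), ?_, ?_, hN, ?_, ?_⟩
  · rw [mem_semiInvariantExponents]
    convert hu using 1
    funext i
    rw [weight_apply]
    push_cast
    have := Int.toNat_sub_toNat_neg (u i + N * r i)
    linear_combination this
  · intro i
    constructor
    · intro hi
      have h1 := huJ' i (Or.inl hi)
      simp only [hi, ne_eq, not_true_eq_false, if_false, zero_sub, false_and] at h1 ⊢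
      rw [h1]
      split_ifs <;> simp
    · intro hi
      have h1 := huJ' i (Or.inr hi)
      simp only [hi, ne_eq, not_true_eq_false, if_false, sub_zero, and_false] at h1 ⊢
      rw [h1]
      split_ifs <;> simp
  · intro i hi
    by_cases hw : w i = 0
    · have h1 := huJ' i (Or.inr hw)
      simp only [hw, hi, ne_eq, not_true_eq_false, not_false_eq_true, if_true, if_false, sub_zero,
        and_false, mul_one] at h1 ⊢
      rw [h1]
      simpa using hN
    · simp [hi, hw]
  · intro i hi
    by_cases hz : z i = 0
    · have h1 := huJ' i (Or.inl hz)
      simp only [hz, hi, ne_eq, not_true_eq_false, not_false_eq_true, if_true, if_false, zero_sub,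
        false_and, mul_neg, mul_one] at h1 ⊢
      rw [h1]
      simpa using hN
    · simp [hi, hz]

/-- Relative to multiples of a generic monomial, every weight and every degree compatible with the
vanishing coordinates is realized by a supported monomial. -/
theorem IsGeneric.exists_isSupported {z w : Fin n → F} {q₀ : Exponent n} (h : IsGeneric z w q₀)
    (hq₀ : q₀ ∈ semiInvariantExponents a r) {u : Fin n → ℤ} (hu : u ∈ weightLattice a) (m : ℤ)
    (hum : ∀ i ∈ zeroSet z w, u i + m * r i = 0) :
    ∃ (K : ℕ) (q : Exponent n), q ∈ semiInvariantExponents a r ∧ IsSupported z w q ∧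
      weight r q = weight r (K • q₀) + u ∧ (q.2.2 : ℤ) = (K • q₀).2.2 + m := by
  classical
  let K : ℕ := m.natAbs + ∑ i, (u i + m * r i).natAbs
  have hKm : 0 ≤ (K * q₀.2.2 : ℤ) + m := by
    have h1 : (m.natAbs : ℤ) ≤ K := by simp only [K]; omega
    have h2 : (1 : ℤ) ≤ q₀.2.2 := by exact_mod_cast h.degree_pos
    have h3 : -m ≤ m.natAbs := by omega
    nlinarith
  have hKi : ∀ i, ((u i + m * r i).natAbs : ℤ) ≤ K := fun i => by
    have := Finset.single_le_sum (f := fun i => (u i + m * r i).natAbs) (fun _ _ => Nat.zero_le _)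
      (Finset.mem_univ i)
    simp only [K]
    omega
  let v : Fin n → ℤ := fun i => K * ((q₀.1 i : ℤ) - q₀.2.1 i) + (u i + m * r i)
  let q : Exponent n := (fun i => (v i).toNat, fun i => (-v i).toNat, (K * q₀.2.2 + m : ℤ).toNat)
  have hdeg : (q.2.2 : ℤ) = K * q₀.2.2 + m := Int.toNat_of_nonneg hKm
  have hw : weight r q = weight r (K • q₀) + u := by
    funext i
    rw [Pi.add_apply, weight_apply, weight_apply, hdeg]
    have := Int.toNat_sub_toNat_neg (v i)
    simp only [q, Prod.smul_fst, Prod.smul_snd, Pi.smul_apply, smul_eq_mul, Nat.cast_mul]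
    rw [this]
    simp only [v]
    ring
  refine ⟨K, q, ?_, fun i => ⟨fun hi => ?_, fun hi => ?_⟩, hw, ?_⟩
  · rw [mem_semiInvariantExponents, hw, map_nsmul]
    exact add_mem ((weightLattice a).smul_of_tower_mem K hq₀) hu
  · have h1 : v i ≤ 0 := by
      simp only [v, (h.isSupported i).1 hi]
      by_cases hwi : w i = 0
      · rw [(h.isSupported i).2 hwi, hum i (mem_zeroSet.2 ⟨hi, hwi⟩)]
        simp
      · have h2 : (1 : ℤ) ≤ q₀.2.1 i := by exact_mod_cast h.right_pos i hwi
        have h3 := hKi i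
        have h4 : u i + m * r i ≤ (u i + m * r i).natAbs := Int.le_natAbs
        push_cast
        nlinarith
    exact Int.toNat_of_nonpos h1
  · have h1 : 0 ≤ v i := by
      simp only [v, (h.isSupported i).2 hi]
      by_cases hzi : z i = 0
      · rw [(h.isSupported i).1 hzi, hum i (mem_zeroSet.2 ⟨hzi, hi⟩)]
        simp
      · have h2 : (1 : ℤ) ≤ q₀.1 i := by exact_mod_cast h.left_pos i hzi
        have h3 := hKi i
        have h4 : -(u i + m * r i) ≤ (u i + m * r i).natAbs := by omega
        push_cast
        nlinarith
    exact Int.toNat_of_nonpos (by omega)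
  · rw [hdeg]
    simp

theorem IsSupported.weight_eq_zero {z w : Fin n → F} {q : Exponent n} (h : IsSupported z w q)
    {i : Fin n} (hi : i ∈ zeroSet z w) : weight r q i + q.2.2 * r i = 0 := by
  rw [mem_zeroSet] at hi
  rw [weight_apply, (h i).1 hi.1, (h i).2 hi.2]
  simp

variable (a r) in
/-- The exponents of the invariant monomials `∏ i, (z i * w i) ^ c i`. -/
def productExponent : (Fin n → ℕ) →+ semiInvariantExponents a r where
  toFun c := ⟨(c, c, 0), by
    rw [mem_semiInvariantExponents]
    convert zero_mem (weightLattice a)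
    funext i
    simp [weight_apply]⟩
  map_zero' := rfl
  map_add' _ _ := rfl

theorem coe_productExponent (c : Fin n → ℕ) :
    (productExponent a r c : Exponent n) = (c, c, 0) := rfl

/-- Two supported monomials of equal weight and degree differ by products `z i * w i` that do not
vanish. -/
theorem IsSupported.exists_add_eq {z w : Fin n → F} {q q' : Exponent n} (h : IsSupported z w q)
    (h' : IsSupported z w q') (hw : weight r q = weight r q') (hd : q.2.2 = q'.2.2) :
    ∃ c c' : Fin n → ℕ, (∀ i, c i ≠ 0 → z i * w i ≠ 0) ∧ (∀ i, c' i ≠ 0 → z i * w i ≠ 0) ∧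
      q + (c, c, 0) = q' + (c', c', 0) := by
  classical
  refine ⟨fun i => if z i * w i = 0 then 0 else q'.2.1 i,
    fun i => if z i * w i = 0 then 0 else q.2.1 i, fun i hi => ?_, fun i hi => ?_, ?_⟩
  · intro h0; simp [h0] at hi
  · intro h0; simp [h0] at hi
  have key : ∀ i, q.1 i + (if z i * w i = 0 then 0 else q'.2.1 i) =
      q'.1 i + (if z i * w i = 0 then 0 else q.2.1 i) ∧
      q.2.1 i + (if z i * w i = 0 then 0 else q'.2.1 i) =
      q'.2.1 i + (if z i * w i = 0 then 0 else q.2.1 i) := by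
    intro i
    have h1 := congrFun hw i
    rw [weight_apply, weight_apply, hd] at h1
    split_ifs with h0
    · rcases mul_eq_zero.1 h0 with h0 | h0
      · have h2 := (h i).1 h0
        have h3 := (h' i).1 h0
        omega
      · have h2 := (h i).2 h0
        have h3 := (h' i).2 h0
        omega
    · omega
  refine Prod.ext (funext fun i => (key i).1) (Prod.ext (funext fun i => (key i).2) ?_)
  simp [hd]

/-- A normal form of an `F`-point of the quotient: a normalized `F`-point of `μ⁻¹(lam)`, and an
`F`-point of the quotient of `Tᵈ` that acts effectively on the orbit of this point. -/
structure NormalForm (a : Fin n → Fin d → ℤ) (lam : lieKernel a →ₗ[ℤ] ℤ) (F : Type) [Field F] where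
  /-- The coordinates `z i`. -/
  z : Fin n → F
  /-- The coordinates `w i`. -/
  w : Fin n → F
  mul_mem : z * w ∈ productSpace a lam F
  isNormalized : IsNormalized z w
  /-- The point of the torus with character lattice `faceLattice a (zeroSet z w)`. -/
  torusPoint : faceLattice a (zeroSet z w) →ₗ[ℤ] Additive Fˣ

variable (a) in
/-- A projection of `weightLattice a` to `faceLattice a S`. -/
def retraction (S : Finset (Fin n)) : weightLattice a →ₗ[ℤ] faceLattice a S :=
  (exists_retraction (a := a) S).choose

theorem retraction_apply {S : Finset (Fin n)} {u : Fin n → ℤ} (hu : u ∈ faceLattice a S) :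
    retraction a S ⟨u, (mem_faceLattice.1 hu).1⟩ = ⟨u, hu⟩ :=
  (exists_retraction (a := a) S).choose_spec u hu

namespace NormalForm

theorem ext_of_forall {D D' : NormalForm a lam F} (hz : D.z = D'.z) (hw : D.w = D'.w)
    (h : ∀ u (hu : u ∈ faceLattice a (zeroSet D.z D.w))
      (hu' : u ∈ faceLattice a (zeroSet D'.z D'.w)),
      D.torusPoint ⟨u, hu⟩ = D'.torusPoint ⟨u, hu'⟩) : D = D' := by
  obtain ⟨z, w, hzw, hnorm, χ⟩ := D
  obtain ⟨z', w', hzw', hnorm', χ'⟩ := D'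
  obtain rfl : z = z' := hz
  obtain rfl : w = w' := hw
  have hχ : χ = χ' := LinearMap.ext fun u => h u u.2 u.2
  rw [hχ]

/-- The homomorphism from the ring of semi-invariants to `F` given by a normal form. -/
def toRingHom (D : NormalForm a lam F) (r : Fin n → ℤ) : semiInvariantRing a r lam →+* F :=
  evalHom D.z D.w D.mul_mem (D.torusPoint.comp (retraction a _)) r

theorem toRingHom_ne_zero_iff (D : NormalForm a lam F) (q : semiInvariantExponents a r) :
    D.toRingHom r (semiMonomial lam q) ≠ 0 ↔ IsSupported D.z D.w q := by
  rw [toRingHom, evalHom_semiMonomial, ← evalMonomial_ne_zero_iff]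
  simp

/-- The quotient of the values of two monomials that do not vanish. -/
theorem toRingHom_div (D : NormalForm a lam F) (q q' : semiInvariantExponents a r)
    {u : Fin n → ℤ} (hu : u ∈ faceLattice a (zeroSet D.z D.w))
    (hw : weight r q = weight r q' + u) :
    D.toRingHom r (semiMonomial lam q) / D.toRingHom r (semiMonomial lam q') =
      ((D.torusPoint ⟨u, hu⟩).toMul : Fˣ) *
        (evalMonomial D.z D.w q / evalMonomial D.z D.w q') := by
  rw [toRingHom, evalHom_semiMonomial, evalHom_semiMonomial, mul_div_mul_comm]
  congr 1
  have h1 : (⟨weight r q, q.2⟩ : weightLattice a) =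
      ⟨weight r q', q'.2⟩ + ⟨u, (mem_faceLattice.1 hu).1⟩ := Subtype.ext hw
  rw [h1, map_add, LinearMap.comp_apply, LinearMap.comp_apply, retraction_apply hu, toMul_add,
    Units.val_mul, mul_div_cancel_left₀ _ (Units.ne_zero _)]

theorem exists_toRingHom_ne_zero (D : NormalForm a lam F) (r : Fin n → ℤ)
    (hind : ∀ x ∈ productSpace a lam F, ∀ S : Finset (Fin n), (∀ i ∈ S, x i = 0) → Indep a S) :
    ∃ m, 0 < m ∧ ∃ s ∈ semiInvariantGrading a r lam m, D.toRingHom r s ≠ 0 := by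
  obtain ⟨q, hq, hg⟩ := exists_isGeneric (hind _ D.mul_mem) r
  exact ⟨_, hg.degree_pos, _, semiMonomial_mem ⟨q, hq⟩,
    (toRingHom_ne_zero_iff D ⟨q, hq⟩).2 hg.isSupported⟩

/-- The field-valued point with a given normal form. -/
def toFieldPoint (r : Fin n → ℤ)
    (hind : ∀ x ∈ productSpace a lam F, ∀ S : Finset (Fin n), (∀ i ∈ S, x i = 0) → Indep a S)
    (D : NormalForm a lam F) : FieldPoint (semiInvariantGrading a r lam) F :=
  FieldPoint.ofRingHom (D.toRingHom r) (D.exists_toRingHom_ne_zero r hind)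

theorem val_toFieldPoint
    (hind : ∀ x ∈ productSpace a lam F, ∀ S : Finset (Fin n), (∀ i ∈ S, x i = 0) → Indep a S)
    (D : NormalForm a lam F) {m : ℕ} {f g : semiInvariantRing a r lam}
    (hf : f ∈ semiInvariantGrading a r lam m) (hg : g ∈ semiInvariantGrading a r lam m) :
    (D.toFieldPoint r hind).val f g = D.toRingHom r f / D.toRingHom r g :=
  FieldPoint.val_ofRingHom _ _ hf hg

end NormalForm

theorem IsNormalized.eq_of_mul_eq {z w z' w' : Fin n → F} (h : IsNormalized z w)
    (h' : IsNormalized z' w') (hz : ∀ i, z i = 0 ↔ z' i = 0) (hw : ∀ i, w i = 0 ↔ w' i = 0)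
    (hzw : z * w = z' * w') : z = z' ∧ w = w' := by
  have key : ∀ i, z i = z' i ∧ w i = w' i := fun i => by
    have h1 := congrFun hzw i
    have h2 := hz i
    have h3 := hw i
    simp only [Pi.mul_apply] at h1
    rcases h i with h4 | ⟨h4, h5 | h5⟩ <;> rcases h' i with h6 | ⟨h6, h7 | h7⟩ <;>
      simp_all
  exact ⟨funext fun i => (key i).1, funext fun i => (key i).2⟩

theorem evalMonomial_productExponent (z w : Fin n → F) (c : Fin n → ℕ) :
    evalMonomial z w (c, c, 0) = ∏ i, (z i * w i) ^ c i := by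
  simp [evalMonomial, mul_pow]

theorem NormalForm.toRingHom_productExponent (D : NormalForm a lam F) (c : Fin n → ℕ) :
    D.toRingHom r (semiMonomial lam (productExponent a r c)) =
      ∏ i, (D.z i * D.w i) ^ c i := by
  have h0 := D.toRingHom_div (r := r) (productExponent a r c) 0 (zero_mem _) (by
    funext i; simp [coe_productExponent, weight_apply])
  rw [semiMonomial_zero, map_one, div_one] at h0
  rw [h0, ← evalMonomial_productExponent]
  have : (⟨0, zero_mem _⟩ : faceLattice a (zeroSet D.z D.w)) = 0 := rfl
  rw [this, map_zero, toMul_zero, Units.val_one, one_mul]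
  simp [evalMonomial, coe_productExponent]

theorem NormalForm.toFieldPoint_injective
    (hind : ∀ x ∈ productSpace a lam F, ∀ S : Finset (Fin n), (∀ i ∈ S, x i = 0) → Indep a S) :
    Function.Injective (NormalForm.toFieldPoint r hind) := by
  classical
  intro D D' h
  have hval : ∀ m, ∀ f ∈ semiInvariantGrading a r lam m, ∀ g ∈ semiInvariantGrading a r lam m,
      D.toRingHom r f / D.toRingHom r g = D'.toRingHom r f / D'.toRingHom r g := by
    intro m f hf g hg
    rw [← val_toFieldPoint hind D hf hg, ← val_toFieldPoint hind D' hf hg, h]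
  have hsupp : ∀ q : semiInvariantExponents a r,
      IsSupported D.z D.w q ↔ IsSupported D'.z D'.w q := by
    intro q
    have h1 := hval _ _ (semiMonomial_mem q) _ (semiMonomial_mem q)
    have h2 : ∀ x : F, x ≠ 0 ↔ x / x ≠ 0 := fun x => by simp
    rw [← D.toRingHom_ne_zero_iff, ← D'.toRingHom_ne_zero_iff, h2, h1, ← h2]
  obtain ⟨q, hq, hg⟩ := exists_isGeneric (hind _ D.mul_mem) r
  obtain ⟨q', hq', hg'⟩ := exists_isGeneric (hind _ D'.mul_mem) r
  have hs := (hsupp ⟨q, hq⟩).1 hg.isSupported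
  have hs' := (hsupp ⟨q', hq'⟩).2 hg'.isSupported
  have hD : D.z = D'.z ∧ D.w = D'.w :=
    D.isNormalized.eq_of_mul_eq D'.isNormalized
      (fun i => ⟨fun hi => by_contra fun hi' => (hg'.left_pos i hi').ne' ((hs' i).1 hi),
        fun hi => by_contra fun hi' => (hg.left_pos i hi').ne' ((hs i).1 hi)⟩)
      (fun i => ⟨fun hi => by_contra fun hi' => (hg'.right_pos i hi').ne' ((hs' i).2 hi),
        fun hi => by_contra fun hi' => (hg.right_pos i hi').ne' ((hs i).2 hi)⟩)
      (funext fun i => by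
        have h2 := hval 0 _ (semiMonomial_mem_of_eq (productExponent a r (Pi.single i 1)) rfl)
          _ (semiMonomial_mem_of_eq 0 rfl)
        rw [semiMonomial_zero, map_one, map_one, div_one, div_one, toRingHom_productExponent,
          toRingHom_productExponent] at h2
        simpa [Pi.single_apply, pow_ite, Finset.prod_ite_eq'] using h2)
  refine NormalForm.ext_of_forall hD.1 hD.2 fun u hu hu' => ?_
  obtain ⟨K, q₁, hq₁, hs₁, hw₁, hd₁⟩ := hg.exists_isSupported hq (mem_faceLattice.1 hu).1 0
    (fun i hi => by rw [(mem_faceLattice.1 hu).2 i hi]; simp)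
  have hd : q₁.2.2 = (K • q).2.2 := by
    rw [add_zero] at hd₁
    exact_mod_cast hd₁
  have h1 := hval _ _ (semiMonomial_mem_of_eq ⟨q₁, hq₁⟩ hd) _
    (semiMonomial_mem ⟨K • q, nsmul_mem hq K⟩)
  have heval : ∀ x, evalMonomial D'.z D'.w x = evalMonomial D.z D.w x := fun x => by
    rw [hD.1, hD.2]
  rw [D.toRingHom_div ⟨q₁, hq₁⟩ ⟨K • q, nsmul_mem hq K⟩ hu hw₁,
    D'.toRingHom_div ⟨q₁, hq₁⟩ ⟨K • q, nsmul_mem hq K⟩ hu' hw₁, heval, heval] at h1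
  exact Units.ext (mul_right_cancel₀ (div_ne_zero (evalMonomial_ne_zero_iff.2 hs₁)
    (evalMonomial_ne_zero_iff.2 (hg.isSupported.nsmul K))) h1)

end NormalForms

/-! ### Reduction of a field-valued point to its normal form -/

section Reduction

variable {n d : ℕ} {a : Fin n → Fin d → ℤ} {lam : lieKernel a →ₗ[ℤ] ℤ} {F : Type} [Field F]
  {r : Fin n → ℤ} (P : FieldPoint (semiInvariantGrading a r lam) F)

/-- The exponents of the semi-invariant monomials that do not vanish at `P`. -/
def FieldPoint.support : AddSubmonoid (semiInvariantExponents a r) where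
  carrier := {q | semiMonomial lam q ∉ P.prime}
  zero_mem' := by
    rw [Set.mem_ofPred_eq, semiMonomial_zero]
    exact (Ideal.ne_top_iff_one _).1 (Ideal.IsPrime.ne_top inferInstance)
  add_mem' {q q'} hq hq' := by
    rw [Set.mem_ofPred_eq, semiMonomial_add]
    exact fun h => (Ideal.IsPrime.mem_or_mem inferInstance h).elim hq hq'

namespace FieldPoint

theorem mem_support {q : semiInvariantExponents a r} :
    q ∈ P.support ↔ semiMonomial lam q ∉ P.prime := Iff.rfl

theorem add_mem_support_iff {q q' : semiInvariantExponents a r} :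
    q + q' ∈ P.support ↔ q ∈ P.support ∧ q' ∈ P.support := by
  refine ⟨fun h => ?_, fun h => add_mem h.1 h.2⟩
  rw [mem_support, semiMonomial_add] at h
  exact ⟨fun h' => h (Ideal.mul_mem_right _ _ h'), fun h' => h (Ideal.mul_mem_left _ _ h')⟩

/-- The value at `P` of the quotient of two monomials. -/
def ratio (q q' : semiInvariantExponents a r) : F :=
  P.val (semiMonomial lam q) (semiMonomial lam q')

variable {P} in
theorem ratio_ne_zero {q q' : semiInvariantExponents a r} (hq : q ∈ P.support)
    (hq' : q' ∈ P.support) (hd : q.1.2.2 = q'.1.2.2) : P.ratio q q' ≠ 0 := fun h =>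
  hq ((P.val_eq_zero_iff (semiMonomial_mem_of_eq q hd) (semiMonomial_mem q') hq').1 h)

theorem ratio_add {q₁ q₁' q₂ q₂' : semiInvariantExponents a r} (h₁ : q₁.1.2.2 = q₁'.1.2.2)
    (h₂ : q₂.1.2.2 = q₂'.1.2.2) :
    P.ratio (q₁ + q₂) (q₁' + q₂') = P.ratio q₁ q₁' * P.ratio q₂ q₂' := by
  rw [ratio, semiMonomial_add, semiMonomial_add]
  exact P.val_mul (semiMonomial_mem_of_eq q₁ h₁) (semiMonomial_mem q₁')
    (semiMonomial_mem_of_eq q₂ h₂) (semiMonomial_mem q₂')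

variable {P} in
theorem ratio_self {q : semiInvariantExponents a r} (hq : q ∈ P.support) : P.ratio q q = 1 :=
  P.val_self (semiMonomial_mem q) hq

variable {P} in
theorem ratio_mul_ratio_swap {q q' : semiInvariantExponents a r} (hq : q ∈ P.support)
    (hq' : q' ∈ P.support) (hd : q.1.2.2 = q'.1.2.2) : P.ratio q q' * P.ratio q' q = 1 := by
  rw [← P.ratio_add hd hd.symm, add_comm q' q]
  exact ratio_self (add_mem hq hq')

/-- The value of the function `z_i * w_i` at `P`. -/
def productValue (i : Fin n) : F := P.ratio (productExponent a r (Pi.single i 1)) 0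

theorem ratio_productExponent_add (c c' : Fin n → ℕ) :
    P.ratio (productExponent a r (c + c')) 0 =
      P.ratio (productExponent a r c) 0 * P.ratio (productExponent a r c') 0 := by
  have h := P.ratio_add (q₁ := productExponent a r c) (q₁' := 0) (q₂ := productExponent a r c')
    (q₂' := 0) rfl rfl
  rwa [add_zero, ← map_add] at h

theorem ratio_productExponent (c : Fin n → ℕ) :
    P.ratio (productExponent a r c) 0 = ∏ i, P.productValue i ^ c i := by
  classical
  have h0 : P.ratio (productExponent a r 0) 0 = 1 := by
    rw [map_zero]
    exact ratio_self (zero_mem _)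
  have h1 : ∀ i k, P.ratio (productExponent a r (Pi.single i k)) 0 = P.productValue i ^ k := by
    intro i k
    induction k with
    | zero => rw [Pi.single_zero, h0, pow_zero]
    | succ k ih => rw [Pi.single_add, ratio_productExponent_add, ih, pow_succ, productValue]
  have h2 : ∀ T : Finset (Fin n), P.ratio (productExponent a r (∑ i ∈ T, Pi.single i (c i))) 0 =
      ∏ i ∈ T, P.productValue i ^ c i := by
    intro T
    induction T using Finset.induction_on with
    | empty => simpa using h0
    | insert i T hi ih =>
      rw [Finset.sum_insert hi, Finset.prod_insert hi, ratio_productExponent_add, ih, h1]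
  simpa [Finset.univ_sum_single] using h2 Finset.univ

theorem productExponent_mem_support_iff (c : Fin n → ℕ) :
    productExponent a r c ∈ P.support ↔ ∀ i, c i ≠ 0 → P.productValue i ≠ 0 := by
  have h0 : semiMonomial lam (0 : semiInvariantExponents a r) ∉ P.prime :=
    P.mem_support.1 (zero_mem _)
  have h1 := P.val_eq_zero_iff (semiMonomial_mem_of_eq (lam := lam) (productExponent a r c) rfl)
    (semiMonomial_mem 0) h0
  rw [mem_support, ← h1.not]
  change P.ratio _ _ ≠ 0 ↔ _
  rw [ratio_productExponent, Finset.prod_ne_zero_iff]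
  simp only [Finset.mem_univ, forall_true_left, ne_eq, pow_eq_zero_iff', not_and, not_not]
  exact forall_congr' fun i => by tauto

theorem productValue_mem : P.productValue ∈ productSpace a lam F := by
  classical
  intro k
  have h1 : Ideal.Quotient.mk (fiberIdeal a lam)
      (momentMap a (fun i => MvPolynomial.X (Sum.inl i)) (fun i => MvPolynomial.X (Sum.inr i)) k
      - MvPolynomial.C (lam k)) = 0 :=
    Ideal.Quotient.eq_zero_iff_mem.2 (Ideal.subset_span ⟨k, rfl⟩)
  have h2 : ∀ i, coordMonomial a lam (Pi.single i 1) (Pi.single i 1) =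
      coord a lam (Sum.inl i) * coord a lam (Sum.inr i) := fun i => by
    rw [coordMonomial, Finset.prod_eq_single i]
    · simp
    · intro j _ hj
      simp [hj]
    · simp
  have hrel : ∑ i, k.1 i • coordMonomial a lam (Pi.single i 1) (Pi.single i 1) =
      lam k • (1 : FiberRing a lam) := by
    simp only [momentMap, LinearMap.coe_mk, AddHom.coe_mk, map_sub, map_sum, map_mul,
      map_intCast, eq_intCast, sub_eq_zero] at h1
    simp only [h2, zsmul_eq_mul, mul_one]
    exact h1
  have h3 : ∑ i, k.1 i • (⟨semiMonomial lam (productExponent a r (Pi.single i 1)),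
      semiMonomial_mem_of_eq _ rfl⟩ : semiInvariantGrading a r lam 0) =
      lam k • ⟨1, SetLike.GradedOne.one_mem⟩ := by
    apply Subtype.ext
    apply Subtype.ext
    simp only [AddSubgroup.coe_zsmul, AddSubmonoidClass.coe_finsetSum]
    change ∑ i, k.1 i • Polynomial.monomial 0 (coordMonomial a lam (Pi.single i 1)
      (Pi.single i 1)) = lam k • (1 : Polynomial (FiberRing a lam))
    rw [← Polynomial.monomial_zero_one, ← map_zsmul, ← hrel, map_sum]
    exact Finset.sum_congr rfl fun i _ => (map_zsmul _ _ _).symm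
  have h4 := congrArg (P.valAddHom (m := 0) SetLike.GradedOne.one_mem) h3
  rw [map_sum, map_zsmul] at h4
  have h5 : P.val 1 1 = 1 := by
    rw [← semiMonomial_zero]
    exact ratio_self (zero_mem _)
  refine Eq.trans (Finset.sum_congr rfl fun i _ => ?_)
    (h4.trans ((congrArg (lam k • ·) h5).trans (by simp)))
  rw [map_zsmul, zsmul_eq_mul, productValue, ratio, semiMonomial_zero]
  rfl

/-- Some monomial that involves `z_i` does not vanish at `P`. -/
def LeftPos (i : Fin n) : Prop := ∃ q ∈ P.support, 0 < q.1.1 i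

/-- Some monomial that involves `w_i` does not vanish at `P`. -/
def RightPos (i : Fin n) : Prop := ∃ q ∈ P.support, 0 < q.1.2.1 i

theorem productValue_ne_zero_iff (i : Fin n) :
    P.productValue i ≠ 0 ↔ P.LeftPos i ∧ P.RightPos i := by
  classical
  have h0 : productExponent a r (Pi.single i 1) ∈ P.support ↔ P.productValue i ≠ 0 := by
    rw [productExponent_mem_support_iff]
    refine ⟨fun h => h i (by simp), fun h j hj => ?_⟩
    obtain rfl : j = i := by
      by_contra hji
      simp [hji] at hj
    exact h
  rw [← h0]
  constructor
  · intro h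
    exact ⟨⟨_, h, by simp [coe_productExponent]⟩, ⟨_, h, by simp [coe_productExponent]⟩⟩
  · rintro ⟨⟨q, hq, hqi⟩, ⟨q', hq', hqi'⟩⟩
    -- the product of the two monomials is divisible by `z_i * w_i`
    let q'' : Exponent n := (q.1.1 + q'.1.1 - Pi.single i 1, q.1.2.1 + q'.1.2.1 - Pi.single i 1,
      q.1.2.2 + q'.1.2.2)
    have hz : Pi.single i 1 + (q.1.1 + q'.1.1 - Pi.single i 1) = q.1.1 + q'.1.1 := by
      apply add_tsub_cancel_of_le
      intro j
      by_cases hj : j = i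
      · subst hj; simp; omega
      · simp [hj]
    have hw : Pi.single i 1 + (q.1.2.1 + q'.1.2.1 - Pi.single i 1) = q.1.2.1 + q'.1.2.1 := by
      apply add_tsub_cancel_of_le
      intro j
      by_cases hj : j = i
      · subst hj; simp; omega
      · simp [hj]
    have hsum : (productExponent a r (Pi.single i 1) : Exponent n) + q'' = q + q' :=
      Prod.ext hz (Prod.ext hw (by simp [q'', coe_productExponent]))
    have hq'' : q'' ∈ semiInvariantExponents a r := by
      have h2 : weight r (productExponent a r (Pi.single i 1)) = 0 := by
        funext j
        simp [coe_productExponent, weight_apply]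
      have h1 : weight r q'' = weight r (q + q') := by
        rw [← hsum, map_add, h2, zero_add]
      rw [mem_semiInvariantExponents, h1]
      exact (q + q').2
    have h2 : productExponent a r (Pi.single i 1) + ⟨q'', hq''⟩ ∈ P.support := by
      rw [show productExponent a r (Pi.single i 1) + ⟨q'', hq''⟩ = q + q' from Subtype.ext hsum]
      exact add_mem hq hq'
    exact (P.add_mem_support_iff.1 h2).1

open Classical in
/-- The coordinates `z_i` of the normal form of `P`. -/
def normalZ (i : Fin n) : F := if P.LeftPos i then 1 else 0

open Classical in
/-- The coordinates `w_i` of the normal form of `P`. -/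
def normalW (i : Fin n) : F :=
  if P.LeftPos i then P.productValue i else if P.RightPos i then 1 else 0

theorem normalZ_eq_zero_iff (i : Fin n) : P.normalZ i = 0 ↔ ¬ P.LeftPos i := by
  simp [normalZ]

theorem normalW_eq_zero_iff (i : Fin n) : P.normalW i = 0 ↔ ¬ P.RightPos i := by
  have h := P.productValue_ne_zero_iff i
  by_cases h1 : P.LeftPos i
  · rw [normalW, if_pos h1, ← not_iff_not, not_not, ← ne_eq, h]
    simp [h1]
  · simp [normalW, h1]

theorem normalZ_mul_normalW : P.normalZ * P.normalW = P.productValue := by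
  funext i
  have h := P.productValue_ne_zero_iff i
  by_cases h1 : P.LeftPos i
  · simp [normalZ, normalW, h1]
  · have h2 : P.productValue i = 0 := by
      by_contra h2
      exact h1 (h.1 h2).1
    simp [normalZ, h1, h2]

theorem isNormalized_normal : IsNormalized P.normalZ P.normalW := by
  intro i
  by_cases h1 : P.LeftPos i
  · simp [normalZ, h1]
  · right
    simp only [normalZ, normalW, h1, if_false, true_and]
    split_ifs <;> simp

theorem isSupported_of_mem_support {q : semiInvariantExponents a r} (hq : q ∈ P.support) :
    IsSupported P.normalZ P.normalW q := by
  intro i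
  rw [normalZ_eq_zero_iff, normalW_eq_zero_iff]
  exact ⟨fun h => by_contra fun h' => h ⟨q, hq, Nat.pos_of_ne_zero h'⟩,
    fun h => by_contra fun h' => h ⟨q, hq, Nat.pos_of_ne_zero h'⟩⟩

theorem exists_mem_support_of_notMem {m : ℕ} {s : semiInvariantRing a r lam}
    (hs : s ∈ semiInvariantGrading a r lam m) (h : s ∉ P.prime) :
    ∃ q ∈ P.support, q.1.2.2 = m := by
  by_contra! h0
  apply h
  have h1 := semiInvariantGrading_le_closure m hs
  have h2 : AddSubgroup.closure {f | ∃ q : semiInvariantExponents a r, q.1.2.2 = m ∧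
      f = semiMonomial lam q} ≤ P.prime.toAddSubgroup := by
    rw [AddSubgroup.closure_le]
    rintro _ ⟨q, hq, rfl⟩
    by_contra h3
    exact h0 q h3 hq
  exact h2 h1

theorem exists_isGeneric_mem_support :
    ∃ q ∈ P.support, IsGeneric P.normalZ P.normalW (q : Exponent n) := by
  classical
  obtain ⟨m, hm, s, hs, hsP⟩ := P.exists_pos_degree_notMem
  obtain ⟨q₀, hq₀, hd₀⟩ := P.exists_mem_support_of_notMem hs hsP
  have hl : ∀ i, ∃ q ∈ P.support, P.LeftPos i → 0 < q.1.1 i := fun i => by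
    by_cases h : P.LeftPos i
    · obtain ⟨q, hq, hqi⟩ := h
      exact ⟨q, hq, fun _ => hqi⟩
    · exact ⟨0, zero_mem _, fun h' => absurd h' h⟩
  have hr : ∀ i, ∃ q ∈ P.support, P.RightPos i → 0 < q.1.2.1 i := fun i => by
    by_cases h : P.RightPos i
    · obtain ⟨q, hq, hqi⟩ := h
      exact ⟨q, hq, fun _ => hqi⟩
    · exact ⟨0, zero_mem _, fun h' => absurd h' h⟩
  choose f hf hfi using hl
  choose g hg hgi using hr
  have hmem : q₀ + (∑ i, f i + ∑ i, g i) ∈ P.support :=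
    add_mem hq₀ (add_mem (sum_mem fun i _ => hf i) (sum_mem fun i _ => hg i))
  have hsumf : ∀ (e : Fin n → semiInvariantExponents a r) (i j : Fin n),
      (e i).1.1 j ≤ (∑ i, e i : semiInvariantExponents a r).1.1 j ∧
      (e i).1.2.1 j ≤ (∑ i, e i : semiInvariantExponents a r).1.2.1 j := by
    intro e i j
    rw [← Finset.add_sum_erase _ _ (Finset.mem_univ i)]
    exact ⟨Nat.le_add_right _ _, Nat.le_add_right _ _⟩
  refine ⟨_, hmem, P.isSupported_of_mem_support hmem, ?_, fun i hi => ?_, fun i hi => ?_⟩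
  · exact lt_of_lt_of_le (hd₀ ▸ hm) (Nat.le_add_right _ _)
  · rw [ne_eq, normalZ_eq_zero_iff, not_not] at hi
    have h1 := (hfi i hi).trans_le (hsumf f i i).1
    exact h1.trans_le ((Nat.le_add_right _ _).trans (Nat.le_add_left _ _))
  · rw [ne_eq, normalW_eq_zero_iff, not_not] at hi
    have h1 := (hgi i hi).trans_le (hsumf g i i).2
    exact h1.trans_le ((Nat.le_add_left _ _).trans (Nat.le_add_left _ _))

theorem mem_support_of_weight_eq {q q' : semiInvariantExponents a r}
    (hq : IsSupported P.normalZ P.normalW q) (hq' : q' ∈ P.support)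
    (hw : weight r q = weight r q') (hd : q.1.2.2 = q'.1.2.2) : q ∈ P.support := by
  obtain ⟨c, c', -, hc', h⟩ := hq.exists_add_eq (P.isSupported_of_mem_support hq') hw hd
  have h1 : q + productExponent a r c = q' + productExponent a r c' := Subtype.ext h
  have h2 : productExponent a r c' ∈ P.support :=
    (P.productExponent_mem_support_iff c').2 fun i hi => by
      rw [← normalZ_mul_normalW]
      exact hc' i hi
  exact (P.add_mem_support_iff.1 (h1 ▸ add_mem hq' h2)).1

theorem mem_support_iff (q : semiInvariantExponents a r) :
    q ∈ P.support ↔ IsSupported P.normalZ P.normalW q := by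
  refine ⟨fun h => P.isSupported_of_mem_support h, fun h => ?_⟩
  -- a complementary monomial brings the weight to that of a power of a generic monomial
  obtain ⟨q₀, hq₀, hg⟩ := P.exists_isGeneric_mem_support
  obtain ⟨K, q', hq', hs', hw', hd'⟩ := hg.exists_isSupported q₀.2
    (u := -weight r q) (neg_mem q.2) (-q.1.2.2) (fun i hi => by
      have := h.weight_eq_zero (r := r) hi
      simp only [Pi.neg_apply]
      linear_combination -this)
  have h1 : q + ⟨q', hq'⟩ ∈ P.support := by
    refine P.mem_support_of_weight_eq (h.add hs') (nsmul_mem hq₀ K) ?_ ?_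
    · rw [AddSubmonoid.coe_add, map_add, hw']
      simp
    · have : ((q.1.2.2 + q'.2.2 : ℕ) : ℤ) = ((K • q₀.1).2.2 : ℕ) := by
        push_cast
        rw [hd']
        ring
      exact_mod_cast this
  exact (P.add_mem_support_iff.1 h1).1

theorem ratio_eq_of_weight_eq {q q' : semiInvariantExponents a r} (hq : q ∈ P.support)
    (hq' : q' ∈ P.support) (hw : weight r q = weight r q') (hd : q.1.2.2 = q'.1.2.2) :
    P.ratio q q' =
      evalMonomial P.normalZ P.normalW q / evalMonomial P.normalZ P.normalW q' := by
  obtain ⟨c, c', hc, hc', h⟩ := (P.isSupported_of_mem_support hq).exists_add_eq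
    (P.isSupported_of_mem_support hq') hw hd
  have hcP : ∏ i, P.productValue i ^ c i ≠ 0 :=
    Finset.prod_ne_zero_iff.2 fun i _ h0 => by
      rw [pow_eq_zero_iff'] at h0
      exact hc i h0.2 (by rw [← h0.1, ← normalZ_mul_normalW, Pi.mul_apply])
  have h1 : q + productExponent a r c = q' + productExponent a r c' := Subtype.ext h
  have h2 := P.ratio_add (q₁ := q) (q₁' := q') (q₂ := productExponent a r c) (q₂' := 0) hd rfl
  have h3 := P.ratio_add (q₁ := q') (q₁' := q') (q₂ := productExponent a r c') (q₂' := 0) rfl rfl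
  rw [h1, h3, ratio_self hq', ratio_productExponent, ratio_productExponent, one_mul] at h2
  have h4 := congrArg (evalMonomial P.normalZ P.normalW) h
  rw [evalMonomial_add, evalMonomial_add, evalMonomial_productExponent,
    evalMonomial_productExponent] at h4
  simp only [show ∀ i, P.normalZ i * P.normalW i = P.productValue i from
    congrFun P.normalZ_mul_normalW] at h4
  have h5 := evalMonomial_ne_zero_iff.2 (P.isSupported_of_mem_support hq')
  rw [eq_div_iff h5]
  apply mul_right_cancel₀ hcP
  rw [h4, h2]
  ring

/-- The quotient of the values of two monomials at `P` and at the point with the coordinates of the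
normal form. -/
def twist (q q' : semiInvariantExponents a r) : F :=
  P.ratio q q' *
    (evalMonomial P.normalZ P.normalW q' / evalMonomial P.normalZ P.normalW q)

/-- `twist` depends only on the difference of the weights. -/
theorem twist_eq_twist {q₁ q₁' q₂ q₂' : semiInvariantExponents a r} (h₁ : q₁ ∈ P.support)
    (h₁' : q₁' ∈ P.support) (h₂ : q₂ ∈ P.support) (h₂' : q₂' ∈ P.support)
    (hd₁ : q₁.1.2.2 = q₁'.1.2.2) (hd₂ : q₂.1.2.2 = q₂'.1.2.2)
    (hw : weight r q₁ + weight r q₂' = weight r q₁' + weight r q₂) :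
    P.twist q₁ q₁' = P.twist q₂ q₂' := by
  have h3 := P.ratio_eq_of_weight_eq (add_mem h₁ h₂') (add_mem h₁' h₂)
    (by rw [AddSubmonoid.coe_add, AddSubmonoid.coe_add, map_add, map_add, hw])
    (congrArg₂ (· + ·) hd₁ hd₂.symm)
  rw [P.ratio_add hd₁ hd₂.symm, AddSubmonoid.coe_add, AddSubmonoid.coe_add, evalMonomial_add,
    evalMonomial_add] at h3
  have h4 := ratio_mul_ratio_swap h₂ h₂' hd₂
  have e₁ := evalMonomial_ne_zero_iff.2 (P.isSupported_of_mem_support h₁)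
  have e₁' := evalMonomial_ne_zero_iff.2 (P.isSupported_of_mem_support h₁')
  have e₂ := evalMonomial_ne_zero_iff.2 (P.isSupported_of_mem_support h₂)
  have e₂' := evalMonomial_ne_zero_iff.2 (P.isSupported_of_mem_support h₂')
  rw [eq_div_iff (mul_ne_zero e₁' e₂)] at h3
  rw [twist, twist, ← mul_div_assoc, ← mul_div_assoc, div_eq_div_iff e₁ e₂]
  linear_combination P.ratio q₂ q₂' * h3 -
    P.ratio q₁ q₁' * evalMonomial P.normalZ P.normalW q₁' *
      evalMonomial P.normalZ P.normalW q₂ * h4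

variable {P} in
theorem twist_ne_zero {q q' : semiInvariantExponents a r} (hq : q ∈ P.support)
    (hq' : q' ∈ P.support) (hd : q.1.2.2 = q'.1.2.2) : P.twist q q' ≠ 0 :=
  mul_ne_zero (ratio_ne_zero hq hq' hd) (div_ne_zero
    (evalMonomial_ne_zero_iff.2 (P.isSupported_of_mem_support hq'))
    (evalMonomial_ne_zero_iff.2 (P.isSupported_of_mem_support hq)))

theorem twist_add {q₁ q₁' q₂ q₂' : semiInvariantExponents a r}
    (hd₁ : q₁.1.2.2 = q₁'.1.2.2) (hd₂ : q₂.1.2.2 = q₂'.1.2.2) :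
    P.twist (q₁ + q₂) (q₁' + q₂') = P.twist q₁ q₁' * P.twist q₂ q₂' := by
  rw [twist, P.ratio_add hd₁ hd₂, AddSubmonoid.coe_add, AddSubmonoid.coe_add, evalMonomial_add,
    evalMonomial_add, mul_div_mul_comm, twist, twist]
  ring

theorem exists_weight_eq_add (u : faceLattice a (zeroSet P.normalZ P.normalW)) :
    ∃ q q' : semiInvariantExponents a r, q ∈ P.support ∧ q' ∈ P.support ∧
      q.1.2.2 = q'.1.2.2 ∧ weight r q = weight r q' + u := by
  obtain ⟨q₀, hq₀, hg⟩ := P.exists_isGeneric_mem_support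
  obtain ⟨K, q, hq, hs, hw, hd⟩ := hg.exists_isSupported q₀.2 (mem_faceLattice.1 u.2).1 0
    (fun i hi => by rw [(mem_faceLattice.1 u.2).2 i hi]; simp)
  refine ⟨⟨q, hq⟩, K • q₀, (P.mem_support_iff _).2 hs, nsmul_mem hq₀ K, ?_, hw⟩
  rw [add_zero] at hd
  exact_mod_cast hd

theorem exists_torusPoint :
    ∃ χ : faceLattice a (zeroSet P.normalZ P.normalW) →ₗ[ℤ] Additive Fˣ,
      ∀ u : faceLattice a (zeroSet P.normalZ P.normalW),
        ∀ q ∈ P.support, ∀ q' ∈ P.support, q.1.2.2 = q'.1.2.2 →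
        weight r q = weight r q' + u → ((χ u).toMul : Fˣ) = P.twist q q' := by
  choose q q' h h' hd hw using P.exists_weight_eq_add
  refine ⟨AddMonoidHom.toIntLinearMap (AddMonoidHom.mk'
    (fun u => Additive.ofMul (Units.mk0 (P.twist (q u) (q' u)) (twist_ne_zero (h u) (h' u) (hd u))))
    fun u v => ?_), fun u p hp p' hp' hdp hwp => ?_⟩
  · rw [← ofMul_mul]
    congr 1
    apply Units.ext
    rw [Units.val_mul, Units.val_mk0, Units.val_mk0, Units.val_mk0, ← P.twist_add (hd u) (hd v)]
    refine P.twist_eq_twist (h _) (h' _) (add_mem (h u) (h v)) (add_mem (h' u) (h' v)) (hd _)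
      (congrArg₂ (· + ·) (hd u) (hd v)) ?_
    rw [AddSubmonoid.coe_add, AddSubmonoid.coe_add, map_add, map_add]
    have huv : ((u + v : faceLattice a (zeroSet P.normalZ P.normalW)) : Fin n → ℤ) = u + v := rfl
    linear_combination hw (u + v) - hw u - hw v + huv
  · exact P.twist_eq_twist (h u) (h' u) hp hp' (hd u) hdp (by linear_combination hw u - hwp)

/-- The torus point of the normal form of `P`. -/
def normalTorusPoint : faceLattice a (zeroSet P.normalZ P.normalW) →ₗ[ℤ] Additive Fˣ :=
  P.exists_torusPoint.choose

theorem normalTorusPoint_apply (u : faceLattice a (zeroSet P.normalZ P.normalW))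
    {q q' : semiInvariantExponents a r} (h : q ∈ P.support) (h' : q' ∈ P.support)
    (hd : q.1.2.2 = q'.1.2.2) (hw : weight r q = weight r q' + u) :
    ((P.normalTorusPoint u).toMul : Fˣ) = P.twist q q' :=
  P.exists_torusPoint.choose_spec u q h q' h' hd hw

/-- The normal form of a field-valued point. -/
def normalForm : NormalForm a lam F where
  z := P.normalZ
  w := P.normalW
  mul_mem := P.normalZ_mul_normalW ▸ P.productValue_mem
  isNormalized := P.isNormalized_normal
  torusPoint := P.normalTorusPoint

theorem val_semiMonomial_eq (q q' : semiInvariantExponents a r) (hq' : q' ∈ P.support)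
    (hd : q.1.2.2 = q'.1.2.2) :
    P.val (semiMonomial lam q) (semiMonomial lam q') =
      P.normalForm.toRingHom r (semiMonomial lam q) /
        P.normalForm.toRingHom r (semiMonomial lam q') := by
  by_cases hq : q ∈ P.support
  · have hs := P.isSupported_of_mem_support hq
    have hs' := P.isSupported_of_mem_support hq'
    have hu : weight r q - weight r q' ∈ faceLattice a (zeroSet P.normalZ P.normalW) := by
      refine mem_faceLattice.2 ⟨sub_mem q.2 q'.2, fun i hi => ?_⟩
      have h1 := hs.weight_eq_zero (r := r) hi
      have h2 := hs'.weight_eq_zero (r := r) hi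
      rw [hd] at h1
      rw [Pi.sub_apply]
      linarith
    have hw : weight r q = weight r q' + (weight r q - weight r q') := by abel
    rw [P.normalForm.toRingHom_div q q' hu hw]
    change P.ratio q q' = ((P.normalTorusPoint ⟨_, hu⟩).toMul : Fˣ) * _
    rw [P.normalTorusPoint_apply ⟨_, hu⟩ hq hq' hd hw, twist, mul_assoc]
    have e := evalMonomial_ne_zero_iff.2 hs
    have e' := evalMonomial_ne_zero_iff.2 hs'
    change _ = P.ratio q q' * (evalMonomial P.normalZ P.normalW q' /
      evalMonomial P.normalZ P.normalW q * (evalMonomial P.normalZ P.normalW q /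
      evalMonomial P.normalZ P.normalW q'))
    rw [div_mul_div_cancel₀ e, div_self e', mul_one]
  · have h1 : P.normalForm.toRingHom r (semiMonomial lam q) = 0 := by
      by_contra h1
      exact hq ((P.mem_support_iff q).2 ((P.normalForm.toRingHom_ne_zero_iff q).1 h1))
    rw [h1, zero_div]
    exact (P.val_eq_zero_iff (semiMonomial_mem_of_eq q hd) (semiMonomial_mem q') hq').2
      (not_not.1 hq)

end FieldPoint

/-- Every field-valued point has a normal form. -/
theorem NormalForm.toFieldPoint_surjective
    (hind : ∀ x ∈ productSpace a lam F, ∀ S : Finset (Fin n), (∀ i ∈ S, x i = 0) → Indep a S) :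
    Function.Surjective (NormalForm.toFieldPoint (a := a) (lam := lam) r hind) := by
  intro P
  refine ⟨P.normalForm, FieldPoint.ext_val fun m f hf g hg => ?_⟩
  rw [NormalForm.val_toFieldPoint hind _ hf hg]
  by_cases h : ∃ q ∈ P.support, q.1.2.2 = m
  · obtain ⟨q, hq, rfl⟩ := h
    have key : ∀ f ∈ semiInvariantGrading a r lam q.1.2.2, P.val f (semiMonomial lam q) =
        P.normalForm.toRingHom r f / P.normalForm.toRingHom r (semiMonomial lam q) := by
      intro f hf
      let φ : semiInvariantGrading a r lam q.1.2.2 →+ F :=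
        (AddMonoidHom.mulRight (P.normalForm.toRingHom r (semiMonomial lam q))⁻¹).comp
          ((P.normalForm.toRingHom r).toAddMonoidHom.comp
            (semiInvariantGrading a r lam q.1.2.2).subtype)
      have h1 : ∀ f ∈ AddSubgroup.closure {f | ∃ q' : semiInvariantExponents a r,
          q'.1.2.2 = q.1.2.2 ∧ f = semiMonomial lam q'},
          ∃ hf : f ∈ semiInvariantGrading a r lam q.1.2.2,
            P.valAddHom (semiMonomial_mem q) ⟨f, hf⟩ = φ ⟨f, hf⟩ := by
        intro f hf
        induction hf using AddSubgroup.closure_induction with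
        | mem f hf =>
          obtain ⟨q', hd, rfl⟩ := hf
          exact ⟨semiMonomial_mem_of_eq q' hd, (P.val_semiMonomial_eq q' q hq hd).trans
            (div_eq_mul_inv _ _)⟩
        | zero =>
          exact ⟨zero_mem _, (map_zero (P.valAddHom (semiMonomial_mem q))).trans (map_zero φ).symm⟩
        | add x y _ _ hx hy =>
          obtain ⟨hx, hx'⟩ := hx
          obtain ⟨hy, hy'⟩ := hy
          refine ⟨add_mem hx hy, ?_⟩
          have := congrArg₂ (· + ·) hx' hy'
          simp only [← map_add] at this
          exact this
        | neg x _ hx =>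
          obtain ⟨hx, hx'⟩ := hx
          refine ⟨neg_mem hx, ?_⟩
          have := congrArg Neg.neg hx'
          simp only [← map_neg] at this
          exact this
      obtain ⟨hf', h2⟩ := h1 f (semiInvariantGrading_le_closure _ hf)
      exact h2.trans (div_eq_mul_inv _ _).symm
    have h3 : P.normalForm.toRingHom r (semiMonomial lam q) ≠ 0 :=
      (P.normalForm.toRingHom_ne_zero_iff q).2 (P.isSupported_of_mem_support hq)
    rw [P.val_eq_div hf hg (semiMonomial_mem q) hq, key f hf, key g hg,
      div_div_div_cancel_right₀ h3]
  · -- all elements of degree `m` vanish on both sides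
    have h1 : g ∈ P.prime := by
      by_contra h1
      exact h (P.exists_mem_support_of_notMem hg h1)
    have h2 : AddSubgroup.closure {f | ∃ q : semiInvariantExponents a r, q.1.2.2 = m ∧
        f = semiMonomial lam q} ≤ (P.normalForm.toRingHom r).toAddMonoidHom.ker := by
      rw [AddSubgroup.closure_le]
      rintro _ ⟨q, hq, rfl⟩
      by_contra h3
      exact h ⟨q, (P.mem_support_iff q).2 ((P.normalForm.toRingHom_ne_zero_iff q).1 h3), hq⟩
    have h4 : P.normalForm.toRingHom r g = 0 := h2 (semiInvariantGrading_le_closure m hg)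
    rw [P.val_of_mem h1, h4, div_zero]

end Reduction

/-! ### The count -/

section Count

variable {n d : ℕ} {a : Fin n → Fin d → ℤ} {lam : lieKernel a →ₗ[ℤ] ℤ} {F : Type} [Field F]

open Classical in
/-- The pairs in normal form with a given product `x`: there is one if `x ≠ 0`, and for `x = 0` there
are two besides `(0, 0)`. -/
theorem sum_normalized_pairs [Fintype F] (x : F) (Q : ℚ) :
    ∑ p : F × F with (p.1 = 1 ∨ (p.1 = 0 ∧ (p.2 = 0 ∨ p.2 = 1))) ∧ p.1 * p.2 = x,
      (if p.1 = 0 ∧ p.2 = 0 then Q⁻¹ else 1) = 1 + if x = 0 then 1 + Q⁻¹ else 0 := by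
  by_cases hx : x = 0
  · have : (Finset.univ.filter fun p : F × F =>
        (p.1 = 1 ∨ (p.1 = 0 ∧ (p.2 = 0 ∨ p.2 = 1))) ∧ p.1 * p.2 = x) = {(1, 0), (0, 1), (0, 0)} := by
      ext ⟨p, s⟩
      simp only [Finset.mem_filter, Finset.mem_univ, true_and, Finset.mem_insert,
        Finset.mem_singleton, Prod.mk.injEq, hx, mul_eq_zero]
      constructor
      · rintro ⟨rfl | ⟨rfl, rfl | rfl⟩, h⟩ <;> simp_all
      · rintro (⟨rfl, rfl⟩ | ⟨rfl, rfl⟩ | ⟨rfl, rfl⟩) <;> simp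
    rw [this, Finset.sum_insert (by simp), Finset.sum_insert (by simp), Finset.sum_singleton]
    simp [hx]
  · have : (Finset.univ.filter fun p : F × F =>
        (p.1 = 1 ∨ (p.1 = 0 ∧ (p.2 = 0 ∨ p.2 = 1))) ∧ p.1 * p.2 = x) = {(1, x)} := by
      ext ⟨p, s⟩
      simp only [Finset.mem_filter, Finset.mem_univ, true_and, Finset.mem_singleton, Prod.mk.injEq]
      constructor
      · rintro ⟨rfl | ⟨rfl, -⟩, h⟩
        · simpa using h
        · exact absurd (by simpa using h.symm) hx
      · rintro ⟨rfl, rfl⟩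
        simp
    rw [this, Finset.sum_singleton]
    simp [hx]

/-- Normal forms are pairs of a normalized point and a torus point. -/
def normalFormEquiv : NormalForm a lam F ≃
    Σ y : {y : Fin n → F × F // (fun i => (y i).1 * (y i).2) ∈ productSpace a lam F ∧
      ∀ i, (y i).1 = 1 ∨ ((y i).1 = 0 ∧ ((y i).2 = 0 ∨ (y i).2 = 1))},
      (faceLattice a (zeroSet (fun i => (y.1 i).1) (fun i => (y.1 i).2)) →ₗ[ℤ] Additive Fˣ) where
  toFun D := ⟨⟨fun i => (D.z i, D.w i), D.mul_mem, D.isNormalized⟩, D.torusPoint⟩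
  invFun D := ⟨fun i => (D.1.1 i).1, fun i => (D.1.1 i).2, D.1.2.1, D.1.2.2, D.2⟩
  left_inv _ := rfl
  right_inv _ := rfl

theorem finite_normalForm [Finite F] : Finite (NormalForm a lam F) := by
  have : ∀ S, Finite (faceLattice a S →ₗ[ℤ] Additive Fˣ) := fun S => (card_faceLattice_hom S F).1
  exact Finite.of_equiv _ normalFormEquiv.symm

theorem Indep.card_le {S : Finset (Fin n)} (hS : Indep a S) : S.card ≤ d := by
  simpa using hS.fintype_card_le_finrank

theorem mem_matroidComplex {S : Finset (Fin n)} : S ∈ matroidComplex a ↔ Indep a S := by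
  classical
  simp [matroidComplex]

theorem card_normalForm [Finite F]
    (hrank : Module.finrank ℤ (LinearMap.range (latticeMap a)) = d)
    (hind : ∀ x ∈ productSpace a lam F, ∀ S : Finset (Fin n), (∀ i ∈ S, x i = 0) → Indep a S)
    (hcard : ∀ S : Finset (Fin n), Indep a S →
      Nat.card {x : Fin n → F // x ∈ productSpace a lam F ∧ ∀ i ∈ S, x i = 0} =
        Nat.card F ^ (d - S.card)) :
    (Nat.card (NormalForm a lam F) : ℚ) = ∑ S ∈ matroidComplex a,
      (Nat.card F : ℚ) ^ d * ((Nat.card F : ℚ) - 1) ^ (d - S.card) := by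
  classical
  have := Fintype.ofFinite F
  have : ∀ S, Finite (faceLattice a S →ₗ[ℤ] Additive Fˣ) := fun S => (card_faceLattice_hom S F).1
  set Q : ℚ := (Nat.card F : ℚ) - 1 with hQdef
  have hq1 : 1 < Nat.card F := Finite.one_lt_card
  have hQ : Q ≠ 0 := by
    have : (1 : ℚ) < Nat.card F := by exact_mod_cast hq1
    rw [hQdef]
    linarith
  have hq0 : (Nat.card F : ℚ) ≠ 0 := by
    have : (1 : ℚ) < Nat.card F := by exact_mod_cast hq1
    linarith
  -- the weight of a normalized point, as a product of local factors
  let g : (Fin n → F × F) → ℚ := fun y => ∏ i, if (y i).1 = 0 ∧ (y i).2 = 0 then Q⁻¹ else 1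
  have hg : ∀ y : Fin n → F × F, (fun i => (y i).1 * (y i).2) ∈ productSpace a lam F →
      (Nat.card (faceLattice a (zeroSet (fun i => (y i).1) (fun i => (y i).2)) →ₗ[ℤ]
        Additive Fˣ) : ℚ) = Q ^ d * g y := by
    intro y hy
    have h1 := (hind _ hy (zeroSet (fun i => (y i).1) (fun i => (y i).2)) (fun i hi => by
      simp [(mem_zeroSet.1 hi).1])).finrank_faceLattice hrank
    have h2 : g y = Q⁻¹ ^ (zeroSet (fun i => (y i).1) (fun i => (y i).2)).card := by
      simp only [g, zeroSet]
      rw [Finset.prod_ite, Finset.prod_const_one, mul_one, Finset.prod_const]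
    rw [(card_faceLattice_hom _ F).2, h2, Nat.cast_pow, Nat.cast_sub hq1.le, Nat.cast_one, ← hQdef]
    have h3 : Q ^ d = Q ^ Module.finrank ℤ (faceLattice a (zeroSet (fun i => (y i).1)
        (fun i => (y i).2))) * Q ^ (zeroSet (fun i => (y i).1) (fun i => (y i).2)).card := by
      rw [← pow_add, h1]
    rw [h3, inv_pow, mul_assoc, mul_inv_cancel₀ (pow_ne_zero _ hQ), mul_one]
  let W : Finset (Fin n → F) := Finset.univ.filter fun x => x ∈ productSpace a lam F
  let Y : Finset (Fin n → F × F) := Finset.univ.filter fun y =>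
    (fun i => (y i).1 * (y i).2) ∈ productSpace a lam F ∧
      ∀ i, (y i).1 = 1 ∨ ((y i).1 = 0 ∧ ((y i).2 = 0 ∨ (y i).2 = 1))
  have hfiber : ∀ x ∈ W, ∑ y ∈ Y with (fun i => (y i).1 * (y i).2) = x, g y =
      ∏ i, (1 + if x i = 0 then 1 + Q⁻¹ else 0) := by
    intro x hx
    have h1 : (Y.filter fun y => (fun i => (y i).1 * (y i).2) = x) = Fintype.piFinset fun i =>
        Finset.univ.filter fun p : F × F =>
          (p.1 = 1 ∨ (p.1 = 0 ∧ (p.2 = 0 ∨ p.2 = 1))) ∧ p.1 * p.2 = x i := by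
      ext y
      simp only [Y, Finset.mem_filter, Finset.mem_univ, true_and, Fintype.mem_piFinset,
        forall_and, funext_iff]
      constructor
      · rintro ⟨⟨-, h⟩, h'⟩
        exact ⟨h, h'⟩
      · rintro ⟨h, h'⟩
        refine ⟨⟨?_, h⟩, h'⟩
        rw [show (fun i => (y i).1 * (y i).2) = x from funext h']
        exact (Finset.mem_filter.1 hx).2
    rw [h1]
    refine (Finset.prod_univ_sum _
      (fun _ (p : F × F) => if p.1 = 0 ∧ p.2 = 0 then Q⁻¹ else 1)).symm.trans ?_
    exact Finset.prod_congr rfl fun i _ => sum_normalized_pairs (x i) Q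
  have hexpand : ∀ x : Fin n → F, ∏ i, (1 + if x i = 0 then 1 + Q⁻¹ else 0) =
      ∑ S : Finset (Fin n), if ∀ i ∈ S, x i = 0 then (1 + Q⁻¹) ^ S.card else 0 := by
    intro x
    rw [Finset.prod_one_add, Finset.powerset_univ]
    refine Finset.sum_congr rfl fun S _ => ?_
    rw [Finset.prod_ite_zero, Finset.prod_const]
    split_ifs <;> rfl
  have hS : ∀ S : Finset (Fin n), ∑ x ∈ W, (if ∀ i ∈ S, x i = 0 then (1 + Q⁻¹) ^ S.card else 0) =
      if S ∈ matroidComplex a then (1 + Q⁻¹) ^ S.card * (Nat.card F : ℚ) ^ (d - S.card)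
        else 0 := by
    intro S
    rw [← Finset.sum_filter, Finset.sum_const, nsmul_eq_mul, mul_comm]
    split_ifs with h
    · congr 1
      rw [← Nat.cast_pow, ← hcard S (mem_matroidComplex.1 h), Nat.card_eq_fintype_card,
        Fintype.card_subtype, Finset.filter_filter]
    · rw [Finset.filter_eq_empty_iff.2, Finset.card_empty, Nat.cast_zero, mul_zero]
      intro x hx hxS
      exact h (mem_matroidComplex.2 (hind x (Finset.mem_filter.1 hx).2 S hxS))
  rw [Nat.card_congr normalFormEquiv, Nat.card_sigma, Nat.cast_sum,
    Finset.sum_congr rfl fun y _ => hg y.1 y.2.1,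
    ← Finset.sum_subtype Y (by simp [Y]) (fun y => Q ^ d * g y), ← Finset.mul_sum,
    ← Finset.sum_fiberwise_of_maps_to (s := Y) (t := W)
      (g := fun y i => (y i).1 * (y i).2) (fun y hy => by
        simp only [Y, Finset.mem_filter] at hy
        simp [W, hy.2.1]),
    Finset.sum_congr rfl hfiber, Finset.sum_congr rfl fun x _ => hexpand x, Finset.sum_comm,
    Finset.sum_congr rfl fun S _ => hS S, ← Finset.sum_filter,
    Finset.filter_univ_mem, Finset.mul_sum]
  refine Finset.sum_congr rfl fun S hS => ?_
  have hle := (mem_matroidComplex.1 hS).card_le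
  have hc : 1 + Q⁻¹ = Nat.card F / Q := by
    rw [eq_div_iff hQ, add_mul, inv_mul_cancel₀ hQ, hQdef]
    ring
  obtain ⟨k, hk⟩ := Nat.exists_eq_add_of_le hle
  have hk' : d - S.card = k := by omega
  rw [hc, hk', div_pow, hk, pow_add, pow_add]
  field_simp

/-- The point count `∑ S, q ^ d * (q - 1) ^ (d - #S)`, the sum being over the independent sets. -/
def pointCountPolynomial (a : Fin n → Fin d → ℤ) : Polynomial ℤ :=
  ∑ S ∈ matroidComplex a, Polynomial.X ^ d * (Polynomial.X - 1) ^ (d - S.card)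

theorem aeval_pointCountPolynomial (a : Fin n → Fin d → ℤ) {q : ℚ} (hq : q ≠ 0) :
    Polynomial.aeval q (pointCountPolynomial a) =
      q ^ (2 * d) * Polynomial.aeval q⁻¹ (hPolynomial (matroidComplex a) d) := by
  have h1 : Polynomial.aeval q⁻¹ (hPolynomial (matroidComplex a) d) =
      ∑ S ∈ matroidComplex a, q⁻¹ ^ S.card * (1 - q⁻¹) ^ (d - S.card) := by
    rw [← Finset.sum_fiberwise_of_maps_to (t := Finset.range (d + 1)) (g := Finset.card)
      (fun S hS => Finset.mem_range.2
        (Nat.lt_succ_of_le (mem_matroidComplex.1 hS).card_le)), hPolynomial, map_sum]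
    refine Finset.sum_congr rfl fun i _ => ?_
    rw [Finset.sum_congr rfl fun S hS => by rw [(Finset.mem_filter.1 hS).2], Finset.sum_const,
      fNumber]
    simp [mul_assoc]
  rw [h1, pointCountPolynomial, map_sum, Finset.mul_sum]
  refine Finset.sum_congr rfl fun S hS => ?_
  obtain ⟨k, hk⟩ := Nat.exists_eq_add_of_le (mem_matroidComplex.1 hS).card_le
  have hk' : d - S.card = k := by omega
  have h2 : q - 1 = q * (1 - q⁻¹) := by field_simp
  simp only [map_mul, map_pow, map_sub, map_one, Polynomial.aeval_X, hk']
  rw [h2, mul_pow, two_mul, pow_add, hk, pow_add, inv_pow]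
  field_simp

end Count

end Hypertoric

end

theorem proposition3p4 (n d : ℕ) (a : Fin n → Fin d → ℤ) (ha : ∀ i, a i ≠ 0)
    (hrank : Module.finrank ℤ (LinearMap.range (Hypertoric.latticeMap a)) = d)
    (r : Fin n → ℤ) (hr : Hypertoric.IsSimple a r)
    (lam : Hypertoric.lieKernel a →ₗ[ℤ] ℤ) (hlam : Hypertoric.IsRegularValue a lam) :
    ∃ ν : Polynomial ℤ,
      Hypertoric.IsPointCount (Hypertoric.hypertoricVariety a r lam) ν ∧
      ∀ q : ℚ, q ≠ 0 →
        Polynomial.aeval q ν =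
          q ^ (2 * d) *
            Polynomial.aeval q⁻¹ (Hypertoric.hPolynomial (Hypertoric.matroidComplex a) d) := by
  obtain ⟨N, hN⟩ := Filter.eventually_atTop.1
    ((Hypertoric.eventually_indep hlam).and (Hypertoric.eventually_card_productSpace
      (lam := lam) hrank))
  refine ⟨Hypertoric.pointCountPolynomial a, ⟨N, fun F _ _ hF => ?_⟩, fun q hq =>
    Hypertoric.aeval_pointCountPolynomial a hq⟩
  obtain ⟨hind, hcard⟩ := hN _ hF
  have e := (Hypertoric.fieldPointEquiv (Hypertoric.semiInvariantGrading a r lam) F).trans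
    (Equiv.ofBijective _ ⟨Hypertoric.NormalForm.toFieldPoint_injective (r := r) (hind F rfl),
      Hypertoric.NormalForm.toFieldPoint_surjective (r := r) (hind F rfl)⟩).symm
  have := Hypertoric.finite_normalForm (a := a) (lam := lam) (F := F)
  refine ⟨Finite.of_equiv _ e.symm, ?_⟩
  have h1 := Hypertoric.card_normalForm hrank (hind F rfl) (hcard F rfl)
  rw [← Nat.card_congr e] at h1
  have h2 : ((Nat.card (Spec (CommRingCat.of F) ⟶ Hypertoric.hypertoricVariety a r lam) : ℤ) : ℚ) =
      ((Hypertoric.pointCountPolynomial a).eval (Nat.card F : ℤ) : ℤ) := by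
    refine Eq.trans ?_ (h1.trans ?_)
    · rfl
    · simp [Hypertoric.pointCountPolynomial, Polynomial.eval_finsetSum]
  exact_mod_cast h2
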